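/- Let $n\ge 1$, $s\ge 2$, and let $M$ be a smooth manifold of dimension $2n+s$ with a weak metric $f$-structure $(f,Q,\xi_i,\eta^i,g)$, $1\le i\le s$: $g$ is a Riemannian metric, $f$ is a skew-symmetric $(1,1)$-tensor of rank $2n$, $Q$ is a self-adjoint nonsingular $(1,1)$-tensor, the vector fields $\xi_i$ are orthonormal, the $\eta^i$ are 1-forms with $\eta^i(\xi_j)=\delta^i_j$, and $$f^2=-Q+\sum_i\eta^i\otimes\xi_i,\qquad Q\xi_i=\xi_i,\qquad g(fX,fY)=g(X,QY)-\sum_i\eta^i(X)\eta^i(Y).$$ Put $\bar\xi=\sum_i\xi_i$, $\bar\eta=\sum_i\eta^i$ and $\mathcal D=\bigcap_i\ker\eta^i$, and let $\nabla$ be the Levi-Civita connection of $g$. Assume that the structure is normal, i.e. $[f,f]+2\sum_i d\eta^i\otimes\xi_i=0$, where $[f,f]$ is the Nijenhuis torsion and $d\eta(X,Y)=\tfrac12\{X(\eta(Y))-Y(\eta(X))-\eta([X,Y])\}$, and that it is weak $\beta f$-Kenmotsu for a constant $\beta\ne0$: $$(\nabla_Xf)Y=\beta\{g(fX,Y)\,\bar\xi-\bar\eta(Y)\,fX\}\quad\text{for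 all vector fields }X,Y.$$ Let $R_{X,Y}=[\nabla_X,\nabla_Y]-\nabla_{[X,Y]}$, $\mathrm{Ric}(X,Y)=\mathrm{trace}(Z\mapsto R_{Z,X}Y)$, $r=\mathrm{trace}_g\mathrm{Ric}$, and $\mathrm{Ric}^*(X,Y)=\tfrac12\mathrm{trace}(Z\mapsto fR_{X,fY}Z)$. Suppose that $(g,V)$ is a $*$-$\eta$-Ricci soliton, i.e. for some constants $\lambda,\mu\in\mathbb R$ $$\tfrac12\mathcal L_Vg+\mathrm{Ric}^*=\lambda\Big\{g-\sum_i\eta^i\otimes\eta^i\Big\}+(\lambda+\mu)\,\bar\eta\otimes\bar\eta,$$ and that $V=\sum_i\delta^i\xi_i$ for some smooth functions $\delta^i$ on $M$, with $V$ not identically zero. Then $X(\delta^i)=0$ for all $i$ and all $X\in\mathcal D$. Moreover $g$ is $\eta$-Einstein, $$\mathrm{Ric}=a\,g-a\sum_i\eta^i\otimes\eta^i+(a+b)\,\bar\eta\otimes\bar\eta,\qquad a=-2sn\beta^2,\quad b=2(s-1)n\beta^2,$$ and its scalar curvature is constant, $r=-2sn(2n+1)\beta^2$. -/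

import Mathlib

open Bundle Manifold VectorField FiberBundle
open scoped ContDiff

noncomputable section

namespace WeakMetric

section LeviCivita

variable {E : Type*} [NormedAddCommGroup E] [NormedSpace ℝ E] [FiniteDimensional ℝ E]
  {H : Type*} [TopologicalSpace H] {I : ModelWithCorners ℝ E H}
  {M : Type*} [TopologicalSpace M] [ChartedSpace H M] [IsManifold I ∞ M]
  (g : ContMDiffRiemannianMetric I ∞ E (fun x : M => TangentSpace I x))

/-- Half of the right-hand side of the Koszul formula: the value of `g(∇_X Y, Z)` at `x`. -/
def koszul (X Y Z : Π x : M, TangentSpace I x) (x : M) : ℝ :=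
  (1 / 2) * (d% (fun p => g.inner p (Y p) (Z p)) x (X x)
    + d% (fun p => g.inner p (X p) (Z p)) x (Y x)
    - d% (fun p => g.inner p (X p) (Y p)) x (Z x)
    + g.inner x (mlieBracket I X Y x) (Z x)
    - g.inner x (mlieBracket I X Z x) (Y x)
    - g.inner x (mlieBracket I Y Z x) (X x))

set_option linter.unusedSectionVars false in
theorem mdiffAt_metric {X Y : Π x : M, TangentSpace I x} {x : M}
    (hX : MDiffAt (T% X) x) (hY : MDiffAt (T% Y) x) :
    MDiffAt (fun p => g.inner p (X p) (Y p)) x := by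
  have : MDifferentiableAt I (I.prod 𝓘(ℝ))
      (fun m ↦ TotalSpace.mk' ℝ (E := Bundle.Trivial M ℝ) m (g.inner m (X m) (Y m))) x := by
    apply MDifferentiableAt.clm_bundle_apply₂ (F₁ := E) (F₂ := E)
    · exact g.contMDiff.mdifferentiableAt (by simp)
    · exact hX
    · exact hY
  simp only [mdifferentiableAt_totalSpace] at this
  exact this.2

theorem koszul_tensorial_right {X Y : Π x : M, TangentSpace I x} {x : M}
    (hX : MDiffAt (T% X) x) (hY : MDiffAt (T% Y) x) :
    TensorialAt I E (fun Z => koszul g X Y Z x) x where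
  smul {f Z} hf hZ := by
    have e1 : (fun p => g.inner p (Y p) ((f • Z) p)) = fun p => f p * g.inner p (Y p) (Z p) := by
      ext p; simp
    have e2 : (fun p => g.inner p (X p) ((f • Z) p)) = fun p => f p * g.inner p (X p) (Z p) := by
      ext p; simp
    simp only [koszul, e1, e2, mvfderiv_fun_mul hf (mdiffAt_metric g hY hZ),
      mvfderiv_fun_mul hf (mdiffAt_metric g hX hZ), mlieBracket_smul_right hf hZ]
    simp [g.symm x (Z x)]
    ring
  add {Z Z'} hZ hZ' := by
    have e1 : (fun p => g.inner p (Y p) ((Z + Z') p)) =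
        fun p => g.inner p (Y p) (Z p) + g.inner p (Y p) (Z' p) := by
      ext p; simp
    have e2 : (fun p => g.inner p (X p) ((Z + Z') p)) =
        fun p => g.inner p (X p) (Z p) + g.inner p (X p) (Z' p) := by
      ext p; simp
    simp only [koszul, e1, e2, mvfderiv_fun_add (mdiffAt_metric g hY hZ) (mdiffAt_metric g hY hZ'),
      mvfderiv_fun_add (mdiffAt_metric g hX hZ) (mdiffAt_metric g hX hZ'),
      mlieBracket_add_right hZ hZ']
    simp
    ring

theorem koszul_tensorial_left {Y Z : Π x : M, TangentSpace I x} {x : M}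
    (hY : MDiffAt (T% Y) x) (hZ : MDiffAt (T% Z) x) :
    TensorialAt I E (fun X => koszul g X Y Z x) x where
  smul {f X} hf hX := by
    have e1 : (fun p => g.inner p ((f • X) p) (Z p)) = fun p => f p * g.inner p (X p) (Z p) := by
      ext p; simp
    have e2 : (fun p => g.inner p ((f • X) p) (Y p)) = fun p => f p * g.inner p (X p) (Y p) := by
      ext p; simp
    simp only [koszul, e1, e2, mvfderiv_fun_mul hf (mdiffAt_metric g hX hZ),
      mvfderiv_fun_mul hf (mdiffAt_metric g hX hY), mlieBracket_smul_left hf hX]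
    simp
    ring
  add {X X'} hX hX' := by
    have e1 : (fun p => g.inner p ((X + X') p) (Z p)) =
        fun p => g.inner p (X p) (Z p) + g.inner p (X' p) (Z p) := by
      ext p; simp
    have e2 : (fun p => g.inner p ((X + X') p) (Y p)) =
        fun p => g.inner p (X p) (Y p) + g.inner p (X' p) (Y p) := by
      ext p; simp
    simp only [koszul, e1, e2, mvfderiv_fun_add (mdiffAt_metric g hX hZ) (mdiffAt_metric g hX' hZ),
      mvfderiv_fun_add (mdiffAt_metric g hX hY) (mdiffAt_metric g hX' hY),
      mlieBracket_add_left hX hX']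
    simp
    ring

theorem koszul_add_middle {X Y Y' Z : Π x : M, TangentSpace I x} {x : M}
    (hX : MDiffAt (T% X) x) (hY : MDiffAt (T% Y) x) (hY' : MDiffAt (T% Y') x)
    (hZ : MDiffAt (T% Z) x) :
    koszul g X (Y + Y') Z x = koszul g X Y Z x + koszul g X Y' Z x := by
  have e1 : (fun p => g.inner p ((Y + Y') p) (Z p)) =
      fun p => g.inner p (Y p) (Z p) + g.inner p (Y' p) (Z p) := by
    ext p; simp
  have e2 : (fun p => g.inner p (X p) ((Y + Y') p)) =
      fun p => g.inner p (X p) (Y p) + g.inner p (X p) (Y' p) := by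
    ext p; simp
  simp only [koszul, e1, e2, mvfderiv_fun_add (mdiffAt_metric g hY hZ) (mdiffAt_metric g hY' hZ),
    mvfderiv_fun_add (mdiffAt_metric g hX hY) (mdiffAt_metric g hX hY'),
    mlieBracket_add_left hY hY', mlieBracket_add_right hY hY']
  simp
  ring

theorem koszul_smul_middle {f : M → ℝ} {X Y Z : Π x : M, TangentSpace I x} {x : M}
    (hf : MDiffAt f x) (hX : MDiffAt (T% X) x) (hY : MDiffAt (T% Y) x)
    (hZ : MDiffAt (T% Z) x) :
    koszul g X (f • Y) Z x =
      f x * koszul g X Y Z x + d% f x (X x) * g.inner x (Y x) (Z x) := by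
  have e1 : (fun p => g.inner p ((f • Y) p) (Z p)) = fun p => f p * g.inner p (Y p) (Z p) := by
    ext p; simp
  have e2 : (fun p => g.inner p (X p) ((f • Y) p)) = fun p => f p * g.inner p (X p) (Y p) := by
    ext p; simp
  simp only [koszul, e1, e2, mvfderiv_fun_mul hf (mdiffAt_metric g hY hZ),
    mvfderiv_fun_mul hf (mdiffAt_metric g hX hY), mlieBracket_smul_left hf hY,
    mlieBracket_smul_right hf hY]
  simp [g.symm x (Y x)]
  ring

instance finiteDimensional_tangentSpace (x : M) : FiniteDimensional ℝ (TangentSpace I x) :=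
  inferInstanceAs (FiniteDimensional ℝ E)

instance t2Space_tangentSpace (x : M) : T2Space (TangentSpace I x) :=
  inferInstanceAs (T2Space E)

/-- The musical isomorphism `v ↦ g(v, ·)` at a point. -/
def flat (x : M) : TangentSpace I x ≃ₗ[ℝ] (TangentSpace I x →L[ℝ] ℝ) :=
  LinearEquiv.ofBijective (g.inner x).toLinearMap (by
    have inj : Function.Injective (g.inner x).toLinearMap := by
      rw [injective_iff_map_eq_zero]
      intro v hv
      by_contra h
      have := g.pos x v h
      have h0 : g.inner x v = 0 := hv
      simp [h0] at this
    refine ⟨inj, (LinearMap.injective_iff_surjective_of_finrank_eq_finrank ?_).1 inj⟩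
    have e : Module.Dual ℝ (TangentSpace I x) ≃ₗ[ℝ] (TangentSpace I x →L[ℝ] ℝ) :=
      LinearMap.toContinuousLinearMap
    rw [← e.finrank_eq]
    exact (Subspace.dual_finrank_eq).symm)

/-- The inverse musical isomorphism `α ↦ α^♯`. -/
def sharp (x : M) : (TangentSpace I x →L[ℝ] ℝ) →L[ℝ] TangentSpace I x :=
  LinearMap.toContinuousLinearMap (flat g x).symm.toLinearMap

theorem inner_sharp (x : M) (α : TangentSpace I x →L[ℝ] ℝ) (v : TangentSpace I x) :
    g.inner x (sharp g x α) v = α v :=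
  congrArg (fun β : TangentSpace I x →L[ℝ] ℝ => β v) ((flat g x).apply_symm_apply α)

theorem eq_of_inner_eq {x : M} {u v : TangentSpace I x}
    (h : ∀ w, g.inner x u w = g.inner x v w) : u = v :=
  (flat g x).injective (ContinuousLinearMap.ext h)

open Classical in
/-- The Levi-Civita connection as a bare function, defined by the Koszul formula;
`leviCivitaAux g Y x (X x)` is `∇_X Y` at `x`. -/
def leviCivitaAux (Y : Π x : M, TangentSpace I x) (x : M) :
    TangentSpace I x →L[ℝ] TangentSpace I x :=
  if hY : MDiffAt (T% Y) x then
    (sharp g x).comp (TensorialAt.mkHom₂ (fun X Z => koszul g X Y Z x) x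
      (fun _ hZ => koszul_tensorial_left g hY hZ)
      (fun _ hX => koszul_tensorial_right g hX hY))
  else 0

theorem inner_leviCivitaAux {X Y Z : Π x : M, TangentSpace I x} {x : M}
    (hX : MDiffAt (T% X) x) (hY : MDiffAt (T% Y) x) (hZ : MDiffAt (T% Z) x) :
    g.inner x (leviCivitaAux g Y x (X x)) (Z x) = koszul g X Y Z x := by
  simp only [leviCivitaAux, hY, dite_true, ContinuousLinearMap.comp_apply, inner_sharp]
  exact TensorialAt.mkHom₂_apply _ _ hX hZ

theorem inner_leviCivitaAux_extend {Y : Π x : M, TangentSpace I x} {x : M}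
    (hY : MDiffAt (T% Y) x) (u w : TangentSpace I x) :
    g.inner x (leviCivitaAux g Y x u) w = koszul g (extend E u) Y (extend E w) x := by
  have := inner_leviCivitaAux g (mdifferentiableAt_extend I E u) hY
    (mdifferentiableAt_extend I E w)
  simpa using this

/-- The Levi-Civita connection of a Riemannian metric `g`: `leviCivita g Y x (X x)` is `∇_X Y` at `x`. -/
def leviCivita : CovariantDerivative I E (fun x : M => TangentSpace I x) where
  toFun := leviCivitaAux g
  isCovariantDerivativeOnUniv :=
    { add := by
        intro Y Y' x hY hY' _
        ext1 u
        refine eq_of_inner_eq g fun w => ?_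
        have hu := mdifferentiableAt_extend I E u
        have hw := mdifferentiableAt_extend I E w
        rw [inner_leviCivitaAux_extend g (mdifferentiableAt_add_section hY hY'),
          koszul_add_middle g hu hY hY' hw, ← inner_leviCivitaAux_extend g hY,
          ← inner_leviCivitaAux_extend g hY']
        simp
      leibniz := by
        intro Y f x hY hf _
        ext1 u
        refine eq_of_inner_eq g fun w => ?_
        have hu := mdifferentiableAt_extend I E u
        have hw := mdifferentiableAt_extend I E w
        rw [inner_leviCivitaAux_extend g (hf.smul_section hY),
          koszul_smul_middle g hf hu hY hw, ← inner_leviCivitaAux_extend g hY]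
        simp }

theorem inner_leviCivita {X Y Z : Π x : M, TangentSpace I x} {x : M}
    (hX : MDiffAt (T% X) x) (hY : MDiffAt (T% Y) x) (hZ : MDiffAt (T% Z) x) :
    g.inner x (leviCivita g Y x (X x)) (Z x) = koszul g X Y Z x :=
  inner_leviCivitaAux g hX hY hZ

theorem leviCivita_torsion_free {X Y : Π x : M, TangentSpace I x} {x : M}
    (hX : MDiffAt (T% X) x) (hY : MDiffAt (T% Y) x) :
    leviCivita g Y x (X x) - leviCivita g X x (Y x) = mlieBracket I X Y x := by
  refine eq_of_inner_eq g fun w => ?_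
  have hw := mdifferentiableAt_extend I E w
  have h1 := inner_leviCivita g hX hY hw
  have h2 := inner_leviCivita g hY hX hw
  have e : (fun p => g.inner p (Y p) (X p)) = fun p => g.inner p (X p) (Y p) := by
    ext p; exact g.symm _ _ _
  have e' : mlieBracket I Y X x = - mlieBracket I X Y x := mlieBracket_swap_apply
  simp only [koszul, extend_apply_self, e, e'] at h1 h2
  simp only [map_sub, sub_apply, h1, h2]
  simp
  ring

theorem leviCivita_metric {X Y Z : Π x : M, TangentSpace I x} {x : M}
    (hX : MDiffAt (T% X) x) (hY : MDiffAt (T% Y) x) (hZ : MDiffAt (T% Z) x) :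
    d% (fun p => g.inner p (Y p) (Z p)) x (X x) =
      g.inner x (leviCivita g Y x (X x)) (Z x) + g.inner x (Y x) (leviCivita g Z x (X x)) := by
  have e : (fun p => g.inner p (Z p) (Y p)) = fun p => g.inner p (Y p) (Z p) := by
    ext p; exact g.symm _ _ _
  have e' : mlieBracket I Z Y x = - mlieBracket I Y Z x := mlieBracket_swap_apply
  rw [g.symm x (Y x), inner_leviCivita g hX hY hZ, inner_leviCivita g hX hZ hY]
  simp only [koszul, e, e']
  simp
  ring

/-- The vector field `∇_X Y`. -/
def nabla (X Y : Π x : M, TangentSpace I x) (x : M) : TangentSpace I x :=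
  leviCivita g Y x (X x)

/-- `R_{X,Y} Z = ∇_X ∇_Y Z - ∇_Y ∇_X Z - ∇_{[X,Y]} Z` for vector fields. -/
def curvature (X Y Z : Π x : M, TangentSpace I x) (x : M) : TangentSpace I x :=
  nabla g X (nabla g Y Z) x - nabla g Y (nabla g X Z) x - nabla g (mlieBracket I X Y) Z x

/-- The curvature tensor `R_{u,v} w` on tangent vectors at `x`, evaluated on extensions of the
vectors to vector fields that are smooth near `x`. -/
def curvatureAt (x : M) (u v w : TangentSpace I x) : TangentSpace I x :=
  curvature g (extend E u) (extend E v) (extend E w) x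

/-- The trace of an endomorphism of the tangent space, as a sum over a basis; it is stated for bare
functions so that linearity need not be proved first. -/
def traceAt (x : M) (φ : TangentSpace I x → TangentSpace I x) : ℝ :=
  ∑ i, (Module.finBasis ℝ (TangentSpace I x)).coord i
    (φ (Module.finBasis ℝ (TangentSpace I x) i))

set_option linter.unusedSectionVars false in
theorem traceAt_linear (x : M) (φ : TangentSpace I x →ₗ[ℝ] TangentSpace I x) :
    traceAt x φ = LinearMap.trace ℝ (TangentSpace I x) φ := by
  rw [LinearMap.trace_eq_matrix_trace ℝ (Module.finBasis ℝ (TangentSpace I x))]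
  simp [traceAt, Matrix.trace, LinearMap.toMatrix_apply]

/-- The trace with respect to `g` of a bilinear form `B` at `x`: the sum of `B(b_i, (b^i)^♯)` over
a basis `b_i` with dual basis `b^i`. -/
def metricTrace (x : M) (B : TangentSpace I x → TangentSpace I x → ℝ) : ℝ :=
  ∑ i, B (Module.finBasis ℝ (TangentSpace I x) i)
    (sharp g x (LinearMap.toContinuousLinearMap
      ((Module.finBasis ℝ (TangentSpace I x)).coord i)))

/-- The Ricci tensor `Ric(u, v) = trace (z ↦ R_{z,u} v)`. -/
def ricci (x : M) (u v : TangentSpace I x) : ℝ :=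
  traceAt x fun z => curvatureAt g x z u v

/-- The scalar curvature `r = trace_g Ric`. -/
def scalarCurvature (x : M) : ℝ := metricTrace g x (ricci g x)

/-- `(L_V g)(X, Y) = V(g(X, Y)) - g([V, X], Y) - g(X, [V, Y])`. -/
def lieDerivMetric (V X Y : Π x : M, TangentSpace I x) (x : M) : ℝ :=
  d% (fun p => g.inner p (X p) (Y p)) x (V x)
    - g.inner x (mlieBracket I V X x) (Y x) - g.inner x (X x) (mlieBracket I V Y x)

/-- `[S, S](X, Y) = S²[X, Y] + [SX, SY] - S[SX, Y] - S[X, SY]` for a (1,1)-tensor `S`. -/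
def nijenhuis (S : Π x : M, TangentSpace I x →L[ℝ] TangentSpace I x)
    (X Y : Π x : M, TangentSpace I x) (x : M) : TangentSpace I x :=
  S x (S x (mlieBracket I X Y x))
    + mlieBracket I (fun p => S p (X p)) (fun p => S p (Y p)) x
    - S x (mlieBracket I (fun p => S p (X p)) Y x)
    - S x (mlieBracket I X (fun p => S p (Y p)) x)

/-- `dθ(X, Y) = (1/2) (X(θ(Y)) - Y(θ(X)) - θ([X, Y]))` for a 1-form `θ`. -/
def dOneForm (θ : Π x : M, TangentSpace I x →L[ℝ] ℝ)
    (X Y : Π x : M, TangentSpace I x) (x : M) : ℝ :=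
  (1 / 2) * (d% (fun p => θ p (Y p)) x (X x) - d% (fun p => θ p (X p)) x (Y x)
    - θ x (mlieBracket I X Y x))

variable (I) in
/-- `X` is a smooth (`C^∞`) vector field. -/
abbrev SmoothField (X : Π x : M, TangentSpace I x) : Prop :=
  ContMDiff I I.tangent ∞ (fun x => TotalSpace.mk' E (E := fun x : M => TangentSpace I x) x (X x))

end LeviCivita

/-- A weak metric f-structure `(f, Q, ξ_i, η^i, g)` on a smooth manifold of dimension `2n + s`. -/
structure WeakMetricFStructure (n s : ℕ) (M : Type*) [TopologicalSpace M]
    [ChartedSpace (EuclideanSpace ℝ (Fin (2 * n + s))) M]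
    [IsManifold (𝓡 (2 * n + s)) ∞ M] where
  /-- the Riemannian metric -/
  g : ContMDiffRiemannianMetric (𝓡 (2 * n + s)) ∞ (EuclideanSpace ℝ (Fin (2 * n + s)))
    (fun x : M => TangentSpace (𝓡 (2 * n + s)) x)
  f : Π x : M, TangentSpace (𝓡 (2 * n + s)) x →L[ℝ] TangentSpace (𝓡 (2 * n + s)) x
  Q : Π x : M, TangentSpace (𝓡 (2 * n + s)) x →L[ℝ] TangentSpace (𝓡 (2 * n + s)) x
  ξ : Fin s → Π x : M, TangentSpace (𝓡 (2 * n + s)) x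
  η : Fin s → Π x : M, TangentSpace (𝓡 (2 * n + s)) x →L[ℝ] ℝ
  f_smooth : ContMDiff (𝓡 (2 * n + s)) ((𝓡 (2 * n + s)).prod
      𝓘(ℝ, EuclideanSpace ℝ (Fin (2 * n + s)) →L[ℝ] EuclideanSpace ℝ (Fin (2 * n + s)))) ∞
    (fun x => TotalSpace.mk'
      (EuclideanSpace ℝ (Fin (2 * n + s)) →L[ℝ] EuclideanSpace ℝ (Fin (2 * n + s)))
      (E := fun x : M =>
        TangentSpace (𝓡 (2 * n + s)) x →L[ℝ] TangentSpace (𝓡 (2 * n + s)) x) x (f x))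
  Q_smooth : ContMDiff (𝓡 (2 * n + s)) ((𝓡 (2 * n + s)).prod
      𝓘(ℝ, EuclideanSpace ℝ (Fin (2 * n + s)) →L[ℝ] EuclideanSpace ℝ (Fin (2 * n + s)))) ∞
    (fun x => TotalSpace.mk'
      (EuclideanSpace ℝ (Fin (2 * n + s)) →L[ℝ] EuclideanSpace ℝ (Fin (2 * n + s)))
      (E := fun x : M =>
        TangentSpace (𝓡 (2 * n + s)) x →L[ℝ] TangentSpace (𝓡 (2 * n + s)) x) x (Q x))
  ξ_smooth : ∀ i, SmoothField (𝓡 (2 * n + s)) (ξ i)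
  η_smooth : ∀ i, ContMDiff (𝓡 (2 * n + s)) ((𝓡 (2 * n + s)).prod
      𝓘(ℝ, EuclideanSpace ℝ (Fin (2 * n + s)) →L[ℝ] ℝ)) ∞
    (fun x => TotalSpace.mk' (EuclideanSpace ℝ (Fin (2 * n + s)) →L[ℝ] ℝ)
      (E := fun x : M => TangentSpace (𝓡 (2 * n + s)) x →L[ℝ] Bundle.Trivial M ℝ x) x (η i x))
  f_skew : ∀ x u v, g.inner x (f x u) v = - g.inner x u (f x v)
  f_rank : ∀ x, Module.finrank ℝ (LinearMap.range (f x).toLinearMap) = 2 * n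
  Q_selfadjoint : ∀ x u v, g.inner x (Q x u) v = g.inner x u (Q x v)
  Q_nonsingular : ∀ x, Function.Bijective (Q x)
  ξ_orthonormal : ∀ x i j, g.inner x (ξ i x) (ξ j x) = if i = j then 1 else 0
  η_ξ : ∀ x i j, η i x (ξ j x) = if i = j then 1 else 0
  f_sq : ∀ x u, f x (f x u) = - Q x u + ∑ i, η i x u • ξ i x
  Q_ξ : ∀ x i, Q x (ξ i x) = ξ i x
  compatible : ∀ x u v, g.inner x (f x u) (f x v) = g.inner x u (Q x v) - ∑ i, η i x u * η i x v

namespace WeakMetricFStructure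

variable {n s : ℕ} {M : Type*} [TopologicalSpace M]
  [ChartedSpace (EuclideanSpace ℝ (Fin (2 * n + s))) M]
  [IsManifold (𝓡 (2 * n + s)) ∞ M] (S : WeakMetricFStructure n s M)

/-- `ξ̄ = ∑ ξ_i` -/
def ξbar (x : M) : TangentSpace (𝓡 (2 * n + s)) x := ∑ i, S.ξ i x

/-- `η̄ = ∑ η^i` -/
def ηbar (x : M) (u : TangentSpace (𝓡 (2 * n + s)) x) : ℝ := ∑ i, S.η i x u

/-- Membership in the distribution `D = ⋂ ker η^i`. -/
def InD (x : M) (u : TangentSpace (𝓡 (2 * n + s)) x) : Prop := ∀ i, S.η i x u = 0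

/-- The structure is normal: `[f, f] + 2 ∑ dη^i ⊗ ξ_i = 0`. -/
def IsNormal : Prop :=
  ∀ X Y : Π x : M, TangentSpace (𝓡 (2 * n + s)) x,
    SmoothField (𝓡 (2 * n + s)) X → SmoothField (𝓡 (2 * n + s)) Y → ∀ x,
      nijenhuis S.f X Y x + (2 : ℝ) • ∑ i, dOneForm (S.η i) X Y x • S.ξ i x = 0

/-- The defining equation of a weak βf-Kenmotsu manifold:
`(∇_X f) Y = β (g(fX, Y) ξ̄ - η̄(Y) fX)`, where `(∇_X f) Y = ∇_X (fY) - f (∇_X Y)`. -/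
structure IsWeakKenmotsu (β : M → ℝ) : Prop where
  smooth : ContMDiff (𝓡 (2 * n + s)) 𝓘(ℝ) ∞ β
  eq : ∀ X Y : Π x : M, TangentSpace (𝓡 (2 * n + s)) x,
    SmoothField (𝓡 (2 * n + s)) X → SmoothField (𝓡 (2 * n + s)) Y → ∀ x,
      nabla S.g X (fun p => S.f p (Y p)) x - S.f x (nabla S.g X Y x) =
      β x • (S.g.inner x (S.f x (X x)) (Y x) • S.ξbar x - S.ηbar x (Y x) • S.f x (X x))

/-- The *-Ricci tensor `Ric*(u, v) = (1/2) trace (z ↦ f R_{u, fv} z)`. -/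
def starRicci (x : M) (u v : TangentSpace (𝓡 (2 * n + s)) x) : ℝ :=
  (1 / 2) * traceAt x fun z => S.f x (curvatureAt S.g x u (S.f x v) z)

/-- `(g, V)` is a *-η-Ricci soliton with constants `lam`, `mu`:
`(1/2) L_V g + Ric* = λ (g - ∑ η^i ⊗ η^i) + (λ + μ) η̄ ⊗ η̄`. -/
def IsStarEtaRicciSoliton (V : Π x : M, TangentSpace (𝓡 (2 * n + s)) x) (lam mu : ℝ) : Prop :=
  ∀ X Y : Π x : M, TangentSpace (𝓡 (2 * n + s)) x,
    SmoothField (𝓡 (2 * n + s)) X → SmoothField (𝓡 (2 * n + s)) Y → ∀ x,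
      (1 / 2) * lieDerivMetric S.g V X Y x + S.starRicci x (X x) (Y x) =
      lam * (S.g.inner x (X x) (Y x) - ∑ i, S.η i x (X x) * S.η i x (Y x))
        + (lam + mu) * (S.ηbar x (X x) * S.ηbar x (Y x))

/-- `g` is η-Einstein with functions `a`, `b`:
`Ric = a g - a ∑ η^i ⊗ η^i + (a + b) η̄ ⊗ η̄`. -/
structure IsEtaEinstein (a b : M → ℝ) : Prop where
  smooth_a : ContMDiff (𝓡 (2 * n + s)) 𝓘(ℝ) ∞ a
  smooth_b : ContMDiff (𝓡 (2 * n + s)) 𝓘(ℝ) ∞ b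
  eq : ∀ x (u v : TangentSpace (𝓡 (2 * n + s)) x),
    ricci S.g x u v = a x * S.g.inner x u v - a x * ∑ i, S.η i x u * S.η i x v
      + (a x + b x) * (S.ηbar x u * S.ηbar x v)

end WeakMetricFStructure

end WeakMetric

end

/-! Write `P` for the orthogonal projection onto `D`. The Kenmotsu formula for `∇f` forces `[f, f] =
0`, so normality makes every `η^i` closed. It also shows `f(∇_X ξ_i - βX) = 0`, so this vector lies
in the span of the `ξ_j`; closedness and orthonormality then leave `∇_X ξ_i = β PX`
(`IsWeakKenmotsu.nab_ξField`). From this follow `R_{ξ_i,X} Y`, the commutator of `R` with `f`, and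
the Lie derivatives along `ξ_i`: those of `f` and `P` vanish, `L g = 2β g(P·,·)`, and `L Ric* =
-2sβ³ g(f·,f·)` (`mvfderiv_starRicci`).

For `V = ∑ δ^i ξ_i` the soliton equation splits into three blocks. On `D × ξ_i` it says that `δ^i`
is constant along `D`. On `ξ_i × ξ_j` it gives `ξ_j δ^i + ξ_i δ^j = 2(λ + μ)`. On `D × D` it gives
`Ric* = φ g(P·,·)` with `φ = λ - β ∑ δ^i`. Differentiating the last identity along `ξ_i` yields
`2sβ³ g(f·,f·) = -(ξ_i φ + 2βφ) g(P·,·)`. The left side does not involve `i`, so all `ξ_i φ` agree,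
and the second block makes their common value a constant. Both tensors in the identity are
multiplied by `2β` under `L_{ξ_i}`, so one more differentiation gives `ξ_i φ = 0`
(`mvfderiv_starFactor_ξ`).

Hence `f² = -qP` with `q = -φ/(sβ²)`, nonzero because `f ≠ 0`, and `Ric* = -sβ² g(f·,f·)`. By the
Bianchi identity `Ric*(u, v) = -tr(w ↦ f R_{w,u} fv)`; moving `f` out of the curvature produces `f²
= -qP`, so the right side is `q Ric(u, v)` plus explicit terms. Dividing by `q` determines `Ric`
(`ricci_eq_of_starRicci`), and its trace is `r`. -/

noncomputable section

namespace WeakMetric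

open Filter
open scoped Topology

/-! ### Smooth vector fields as a module over the smooth functions. -/

section SmoothFields

set_option linter.unusedSectionVars false

variable {E : Type*} [NormedAddCommGroup E] [NormedSpace ℝ E] [FiniteDimensional ℝ E]
  {H : Type*} [TopologicalSpace H] {I : ModelWithCorners ℝ E H}
  {M : Type*} [TopologicalSpace M] [ChartedSpace H M] [IsManifold I ∞ M]

variable (I M) in
/-- Smooth vector fields on `M`. -/
abbrev VField := Cₛ^∞⟮I; E, (fun x : M => TangentSpace I x)⟯

variable (I M) in
/-- Smooth real functions on `M`. -/
abbrev Fn := C^∞⟮I, M; ℝ⟯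

instance : SMul (Fn I M) (VField I M) :=
  ⟨fun h X => ⟨fun x => h x • X x, h.contMDiff.smul_section X.contMDiff⟩⟩

theorem VField.fsmul_apply (h : Fn I M) (X : VField I M) (x : M) : (h • X) x = h x • X x := rfl

instance : Module (Fn I M) (VField I M) where
  one_smul X := by ext x; exact one_smul ℝ (X x)
  mul_smul a b X := by ext x; exact mul_smul (a x) (b x) (X x)
  smul_zero a := by ext x; exact smul_zero (a x)
  smul_add a X Y := by ext x; exact smul_add (a x) (X x) (Y x)
  add_smul a b X := by ext x; exact add_smul (a x) (b x) (X x)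
  zero_smul X := by ext x; exact zero_smul ℝ (X x)

theorem VField.add_apply (X Y : VField I M) (x : M) : (X + Y) x = X x + Y x := rfl

theorem VField.sub_apply (X Y : VField I M) (x : M) : (X - Y) x = X x - Y x := rfl

theorem VField.neg_apply (X : VField I M) (x : M) : (-X) x = -X x := rfl

/-- Evaluation of vector fields at a point. -/
def VField.evalHom (x : M) : VField I M →+ TangentSpace I x where
  toFun X := X x
  map_zero' := rfl
  map_add' _ _ := rfl

theorem VField.sum_apply {ι : Type*} (t : Finset ι) (X : ι → VField I M) (x : M) :
    (∑ i ∈ t, X i) x = ∑ i ∈ t, X i x :=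
  map_sum (VField.evalHom x) X t

theorem Fn.sum_apply {ι : Type*} (t : Finset ι) (h : ι → Fn I M) (x : M) :
    (∑ i ∈ t, h i) x = ∑ i ∈ t, h i x :=
  map_sum (ContMDiffMap.evalRingHom (I := I) (I' := 𝓘(ℝ)) (n := ∞) x) h t

theorem VField.mdiffAt (X : VField I M) (x : M) : MDiffAt (T% (fun p => X p)) x :=
  X.contMDiff.mdifferentiable (by simp) x

theorem Fn.mdiffAt (h : Fn I M) (x : M) : MDiffAt (fun p => h p) x :=
  h.contMDiff.mdifferentiable (by simp) x

/-- The Lie bracket of smooth vector fields. -/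
def VField.bracket (X Y : VField I M) : VField I M :=
  ⟨mlieBracket I X Y, by
    have e : (((⊤ : ℕ∞) : WithTop ℕ∞) + 1) = ((⊤ : ℕ∞) : WithTop ℕ∞) := rfl
    have : IsManifold I (((⊤ : ℕ∞) : WithTop ℕ∞) + 1) M := by rw [e]; infer_instance
    have : IsManifold I (minSmoothness ℝ 2) M := by
      rw [minSmoothness_of_isRCLikeNormedField]
      exact IsManifold.of_le (n := ∞) (WithTop.coe_le_coe.2 le_top)
    have : CompleteSpace E := FiniteDimensional.complete ℝ E
    -- The bracket costs one derivative, which is harmless because `∞ + 1 = ∞`.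
    exact ContDiff.mlieBracket_vectorField (m := ⊤) (n := ⊤) X.contMDiff Y.contMDiff
      (by simp)⟩

theorem VField.jacobi (X Y Z : VField I M) :
    VField.bracket X (VField.bracket Y Z) =
      VField.bracket (VField.bracket X Y) Z + VField.bracket Y (VField.bracket X Z) := by
  have : CompleteSpace E := FiniteDimensional.complete ℝ E
  have : IsManifold I (minSmoothness ℝ 3) M := by
    simp only [minSmoothness_of_isRCLikeNormedField]
    exact IsManifold.of_le (n := ∞) (WithTop.coe_le_coe.2 le_top)
  have h2 : ((2 : ℕ∞) : WithTop ℕ∞) ≤ ∞ := WithTop.coe_le_coe.2 le_top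
  have h (X : VField I M) : CMDiff (minSmoothness ℝ 2) (T% (fun p => X p)) := by
    simp only [minSmoothness_of_isRCLikeNormedField]
    exact X.contMDiff.of_le h2
  ext x
  exact leibniz_identity_mlieBracket_apply (h X x) (h Y x) (h Z x)

/-- The derivative of a smooth function along a smooth vector field. -/
def VField.der (X : VField I M) (h : Fn I M) : Fn I M :=
  ⟨fun x => mvfderiv I h x (X x), by
    have h1 : ContMDiff I.tangent 𝓘(ℝ).tangent ∞ (tangentMap I 𝓘(ℝ) h) :=
      h.contMDiff.contMDiff_tangentMap le_rfl
    have h2 := h1.comp X.contMDiff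
    exact (contMDiff_snd_tangentBundle_modelSpace ℝ 𝓘(ℝ)).comp h2⟩

theorem VField.der_apply (X : VField I M) (h : Fn I M) (x : M) :
    X.der h x = mvfderiv I h x (X x) := rfl

section Metric

variable (g : ContMDiffRiemannianMetric I ∞ E (fun x : M => TangentSpace I x))

/-- The inner product of smooth vector fields. -/
def VField.inn (X Y : VField I M) : Fn I M :=
  ⟨fun x => g.inner x (X x) (Y x), by
    have : ContMDiff I (I.prod 𝓘(ℝ)) ∞
        (fun m ↦ TotalSpace.mk' ℝ (E := Bundle.Trivial M ℝ) m (g.inner m (X m) (Y m))) := by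
      apply ContMDiff.clm_bundle_apply₂ (F₁ := E) (F₂ := E)
      · exact g.contMDiff
      · exact X.contMDiff
      · exact Y.contMDiff
    intro x
    have := this x
    simp only [contMDiffAt_totalSpace] at this
    exact this.2⟩

theorem VField.inn_apply (X Y : VField I M) (x : M) :
    VField.inn g X Y x = g.inner x (X x) (Y x) := rfl

end Metric

section Extension

variable [T2Space M]

/-- Multiplication by a bump function equal to `1` near `x`. It replaces the local section `extend`,
smooth only near its base point, by a global field with the same germ. -/
theorem exists_vfield_eventuallyEq {σ : Π x : M, TangentSpace I x} {u : Set M} {x : M}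
    (hu : u ∈ 𝓝 x) (hσ : CMDiff[u] ∞ (T% σ)) : ∃ X : VField I M, ∀ᶠ p in 𝓝 x, X p = σ p := by
  obtain ⟨v, hvu, hvo, hxv⟩ := mem_nhds_iff.1 hu
  obtain ⟨ψ, hψ, -⟩ := (SmoothBumpFunction.nhds_basis_support (I := I)
    (hvo.mem_nhds hxv)).mem_iff.1 (hvo.mem_nhds hxv)
  refine ⟨⟨(ψ : M → ℝ) • σ, ContMDiffOn.smul_section_of_tsupport ψ.contMDiff.contMDiffOn hvo
    hψ (hσ.mono hvu)⟩, ?_⟩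
  filter_upwards [ψ.eventuallyEq_one] with p hp
  simp [hp]

theorem exists_vfield_eventuallyEq_extend {x : M} (v : TangentSpace I x) :
    ∃ X : VField I M, ∀ᶠ p in 𝓝 x, X p = extend E v p := by
  obtain ⟨u, hu, h⟩ := exists_contMDiffOn_extend (k := ∞) I E v
  exact exists_vfield_eventuallyEq hu h

theorem exists_vfield_apply_eq {x : M} (v : TangentSpace I x) :
    ∃ X : VField I M, X x = v := by
  obtain ⟨X, hX⟩ := exists_vfield_eventuallyEq_extend v
  exact ⟨X, by simpa using hX.self_of_nhds⟩

/-- A smooth vector field with prescribed value at a point. -/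
def VField.through (x : M) (v : TangentSpace I x) : VField I M := (exists_vfield_apply_eq v).choose

@[simp]
theorem VField.through_apply (x : M) (v : TangentSpace I x) : VField.through x v x = v :=
  (exists_vfield_apply_eq v).choose_spec

end Extension

end SmoothFields

end WeakMetric

end

/-! ### Dual frames, the Levi-Civita derivative on smooth fields, and derivatives of traces. -/

noncomputable section

namespace WeakMetric

open Filter
open scoped Topology

section Frames

set_option linter.unusedSectionVars false

variable {E : Type*} [NormedAddCommGroup E] [NormedSpace ℝ E] [FiniteDimensional ℝ E]
  {H : Type*} [TopologicalSpace H] {I : ModelWithCorners ℝ E H}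
  {M : Type*} [TopologicalSpace M] [ChartedSpace H M] [IsManifold I ∞ M] [T2Space M]
  (g : ContMDiffRiemannianMetric I ∞ E (fun x : M => TangentSpace I x))

theorem exists_fn_eventuallyEq_inv (D : Fn I M) {x : M} (hx : D x ≠ 0) :
    ∃ h : Fn I M, ∀ᶠ p in 𝓝 x, h p * D p = 1 := by
  have hU : {p | D p ≠ 0} ∈ 𝓝 x :=
    (D.contMDiff.continuous.isOpen_preimage _ isOpen_ne).mem_nhds hx
  obtain ⟨ψ, hψ, -⟩ := (SmoothBumpFunction.nhds_basis_support (I := I) hU).mem_iff.1 hU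
  refine ⟨⟨fun p => ψ p • (D p)⁻¹, contMDiff_of_tsupport fun p hp => ?_⟩, ?_⟩
  · have hp' : D p ≠ 0 := hψ (tsupport_smul_subset_left _ _ hp)
    exact (ψ.contMDiff p).smul ((D.contMDiff p).inv₀ hp')
  · filter_upwards [ψ.eventuallyEq_one, hU] with p hp hp'
    have hp1 : ψ p = 1 := hp
    have hp2 : D p ≠ 0 := hp'
    change ψ p * (D p)⁻¹ * D p = 1
    rw [hp1, one_mul, inv_mul_cancel₀ hp2]

/-- Near every point there are smooth fields `e i`, `θ i` which are dual bases with respect to the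
metric. -/
theorem exists_dual_frame (x : M) :
    ∃ e θ : Fin (Module.finrank ℝ E) → VField I M, ∀ᶠ p in 𝓝 x,
      (∀ i j, g.inner p (e i p) (θ j p) = if i = j then 1 else 0) ∧
      ∀ v : TangentSpace I p, v = ∑ i, g.inner p v (θ i p) • e i p := by
  classical
  let t := trivializationAt E (TangentSpace I : M → Type _) x
  let b := Module.finBasis ℝ E
  have ht : t.baseSet ∈ 𝓝 x := t.open_baseSet.mem_nhds (mem_baseSet_trivializationAt E _ x)
  have hs := t.isLocalFrameOn_localFrame_baseSet I ∞ b
  choose e he using fun i => exists_vfield_eventuallyEq ht (hs.contMDiffOn i)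
  let G : Matrix _ _ (Fn I M) := fun i j => VField.inn g (e i) (e j)
  have hGp (p : M) : (ContMDiffMap.evalRingHom (I := I) (I' := 𝓘(ℝ)) (n := ∞) p).mapMatrix G =
      fun i j => g.inner p (e i p) (e j p) := rfl
  have hdet (p : M) (hp : p ∈ t.baseSet) (hep : ∀ i, e i p = t.localFrame b i p) :
      G.det p ≠ 0 := by
    change (ContMDiffMap.evalRingHom (I := I) (I' := 𝓘(ℝ)) (n := ∞) p) G.det ≠ 0
    rw [RingHom.map_det]
    intro h0
    -- A kernel vector of the Gram matrix would give a combination of the frame orthogonal to every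
    -- frame vector, hence to itself.
    obtain ⟨v, hv0, hv⟩ := Matrix.exists_vecMul_eq_zero_iff.2 h0
    have hw : ∀ j, g.inner p (∑ i, v i • e i p) (e j p) = 0 := by
      intro j
      have := congrFun hv j
      simpa [Matrix.vecMul, dotProduct, hGp] using this
    have hww : g.inner p (∑ i, v i • e i p) (∑ i, v i • e i p) = 0 := by
      conv_lhs => rw [map_sum]
      exact Finset.sum_eq_zero fun j _ => by rw [map_smul, hw j, smul_zero]
    have hw0 : ∑ i, v i • e i p = 0 := by
      by_contra h
      exact (g.pos p _ h).ne' hww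
    apply hv0
    ext i
    exact Fintype.linearIndependent_iff.1 (hs.linearIndependent hp) v
      (by simpa [hep] using hw0) i
  have hex : ∀ᶠ p in 𝓝 x, ∀ i, e i p = t.localFrame b i p := eventually_all.2 he
  obtain ⟨h, hh⟩ := exists_fn_eventuallyEq_inv G.det
    (hdet x (mem_of_mem_nhds ht) hex.self_of_nhds)
  -- The dual frame is given by the inverse Gram matrix. The determinant need not be a unit among
  -- global functions, so the inverse is written as the adjugate times `h`, which inverts the
  -- determinant near `x` only.
  refine ⟨e, fun j => ∑ k, (h * G.adjugate j k) • e k, ?_⟩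
  filter_upwards [hex, hh, ht] with p hep hhp hp
  have hdual : ∀ i j, g.inner p (e i p) ((∑ k, (h * G.adjugate j k) • e k : VField I M) p) =
      if i = j then 1 else 0 := by
    intro i j
    have h1 : g.inner p (e i p) ((∑ k, (h * G.adjugate j k) • e k : VField I M) p) =
        (h * (G.adjugate * G) j i) p := by
      rw [VField.sum_apply, map_sum, Matrix.mul_apply, Finset.mul_sum, Fn.sum_apply]
      refine Finset.sum_congr rfl fun k _ => ?_
      rw [VField.fsmul_apply, map_smul, g.symm]
      exact mul_assoc _ _ _
    rw [h1, Matrix.adjugate_mul]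
    by_cases hij : i = j
    · subst hij
      simpa using hhp
    · simp [hij, Ne.symm hij]
  refine ⟨hdual, fun v => ?_⟩
  have hv := (hs.toBasisAt hp).sum_repr v
  simp only [hs.toBasisAt_coe, ← hep] at hv
  set c := (hs.toBasisAt hp).repr v
  have hc : ∀ j, g.inner p v ((∑ k, (h * G.adjugate j k) • e k : VField I M) p) = c j := by
    intro j
    conv_lhs => rw [← hv]
    simp only [map_sum, map_smul, sum_apply, smul_apply,
      hdual]
    simp
  simp only [hc]
  exact hv.symm

/-- The coefficients of `σ` in the frame `e` are its pairings with the dual frame `θ`. This is what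
gives smoothness of `∇_X Y`, which the Koszul formula describes only through its inner products. -/
theorem contMDiffAt_of_inner {σ : Π x : M, TangentSpace I x} {x : M}
    (h : ∀ Z : VField I M, CMDiffAt ∞ (fun p => g.inner p (σ p) (Z p)) x) :
    CMDiffAt ∞ (T% σ) x := by
  obtain ⟨e, θ, he⟩ := exists_dual_frame g x
  have h1 : CMDiffAt ∞ (T% (fun p => ∑ i, g.inner p (σ p) (θ i p) • e i p)) x :=
    .sum_section fun i _ => (h (θ i)).smul_section (e i).contMDiff.contMDiffAt
  refine h1.congr_of_eventuallyEq ?_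
  filter_upwards [he] with p hp
  exact congrArg (TotalSpace.mk' E p) (hp.2 (σ p))

/-- The Koszul expression of smooth fields, as a smooth function. -/
def VField.koszulFn (X Y Z : VField I M) : Fn I M :=
  (1 / 2 : ℝ) • (X.der (VField.inn g Y Z) + Y.der (VField.inn g X Z) - Z.der (VField.inn g X Y)
    + VField.inn g (X.bracket Y) Z - VField.inn g (X.bracket Z) Y - VField.inn g (Y.bracket Z) X)

/-- The Levi-Civita covariant derivative of smooth fields. -/
def VField.nab (X Y : VField I M) : VField I M :=
  ⟨nabla g X Y, fun x => contMDiffAt_of_inner g fun Z => by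
    have : (fun p => g.inner p (nabla g X Y p) (Z p)) = VField.koszulFn g X Y Z := by
      ext p
      exact inner_leviCivita g (X.mdiffAt p) (Y.mdiffAt p) (Z.mdiffAt p)
    rw [this]
    exact (VField.koszulFn g X Y Z).contMDiff x⟩

theorem VField.bracket_eq (X Y : VField I M) :
    X.bracket Y = VField.nab g X Y - VField.nab g Y X := by
  ext x
  exact (leviCivita_torsion_free g (X.mdiffAt x) (Y.mdiffAt x)).symm

theorem VField.der_inn (X Y Z : VField I M) :
    X.der (VField.inn g Y Z) =
      VField.inn g (VField.nab g X Y) Z + VField.inn g Y (VField.nab g X Z) := by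
  ext x
  exact leviCivita_metric g (X.mdiffAt x) (Y.mdiffAt x) (Z.mdiffAt x)

theorem VField.inn_comm (X Y : VField I M) : VField.inn g X Y = VField.inn g Y X := by
  ext x
  exact g.symm x _ _

theorem VField.nab_add_left (X X' Y : VField I M) :
    VField.nab g (X + X') Y = VField.nab g X Y + VField.nab g X' Y := by
  ext x
  exact map_add (leviCivita g Y x) (X x) (X' x)

theorem VField.nab_smul_left (h : Fn I M) (X Y : VField I M) :
    VField.nab g (h • X) Y = h • VField.nab g X Y := by
  ext x
  exact map_smul (leviCivita g Y x) (h x) (X x)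

theorem VField.nab_add_right (X Y Y' : VField I M) :
    VField.nab g X (Y + Y') = VField.nab g X Y + VField.nab g X Y' := by
  ext x
  exact congrArg (fun l => l (X x))
    ((leviCivita g).isCovariantDerivativeOnUniv.add (Y.mdiffAt x) (Y'.mdiffAt x))

theorem VField.nab_smul_right (h : Fn I M) (X Y : VField I M) :
    VField.nab g X (h • Y) = h • VField.nab g X Y + X.der h • Y := by
  ext x
  exact congrArg (fun l => l (X x))
    ((leviCivita g).isCovariantDerivativeOnUniv.leibniz (Y.mdiffAt x) (h.mdiffAt x))

theorem VField.der_add (X : VField I M) (a b : Fn I M) :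
    X.der (a + b) = X.der a + X.der b := by
  ext x
  exact congrArg (fun l => l (X x)) (mvfderiv_fun_add (a.mdiffAt x) (b.mdiffAt x))

theorem VField.der_mul (X : VField I M) (a b : Fn I M) :
    X.der (a * b) = a * X.der b + b * X.der a := by
  ext x
  exact congrArg (fun l => l (X x)) (mvfderiv_fun_mul (a.mdiffAt x) (b.mdiffAt x))

theorem VField.der_add_left (X Y : VField I M) (a : Fn I M) :
    (X + Y).der a = X.der a + Y.der a := by
  ext x
  exact map_add (mvfderiv I a x) (X x) (Y x)

theorem VField.der_smul_left (h : Fn I M) (X : VField I M) (a : Fn I M) :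
    (h • X).der a = h * X.der a := by
  ext x
  exact map_smul (mvfderiv I a x) (h x) (X x)

theorem VField.der_algebraMap (X : VField I M) (c : ℝ) :
    X.der (algebraMap ℝ (Fn I M) c) = 0 := by
  ext x
  exact congrArg (fun l => l (X x)) (mvfderiv_const (I := I) c (x := x))

theorem VField.bracket_smul_right (h : Fn I M) (X Y : VField I M) :
    X.bracket (h • Y) = X.der h • Y + h • X.bracket Y := by
  ext x
  exact mlieBracket_smul_right (h.mdiffAt x) (Y.mdiffAt x)

theorem VField.bracket_add_right (X Y Z : VField I M) :
    X.bracket (Y + Z) = X.bracket Y + X.bracket Z := by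
  ext x
  exact mlieBracket_add_right (Y.mdiffAt x) (Z.mdiffAt x)

/-- The Jacobi identity for `X`, `Y`, `hZ`, minus `h` times the one for `X`, `Y`, `Z`, leaves
exactly this identity multiplied by `Z`. A field nonzero at the point then cancels; if the tangent
space is zero, all derivatives vanish. -/
theorem VField.der_bracket (X Y : VField I M) (h : Fn I M) :
    (X.bracket Y).der h = X.der (Y.der h) - Y.der (X.der h) := by
  have key (Z : VField I M) :
      (X.bracket Y).der h • Z = (X.der (Y.der h) - Y.der (X.der h)) • Z := by
    have h1 := VField.jacobi X Y (h • Z)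
    have h2 := VField.jacobi X Y Z
    simp only [VField.bracket_smul_right, VField.bracket_add_right, h2] at h1
    rw [sub_smul]
    linear_combination (norm := module) (-1 : ℤ) • h1
  ext x
  by_cases hE : ∃ v : TangentSpace I x, v ≠ 0
  · obtain ⟨v, hv⟩ := hE
    have := congrArg (fun W : VField I M => W x) (key (VField.through x v))
    simp only [VField.fsmul_apply, VField.through_apply] at this
    exact smul_left_injective ℝ hv this
  · push Not at hE
    simp [VField.der_apply, hE, ContMDiffMap.coe_sub]

theorem trace_eq_sum_of_dual {ι : Type*} [Fintype ι] {p : M} {e θ : ι → TangentSpace I p}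
    (h : ∀ v : TangentSpace I p, v = ∑ i, g.inner p v (θ i) • e i)
    (a : TangentSpace I p →ₗ[ℝ] TangentSpace I p) :
    LinearMap.trace ℝ _ a = ∑ i, g.inner p (a (e i)) (θ i) := by
  have : a = ∑ i, (g.inner p (θ i)).toLinearMap.smulRight (a (e i)) := by
    ext v
    conv_lhs => rw [h v]
    simp [g.symm p v]
  conv_lhs => rw [this]
  simp [g.symm p (θ _)]

theorem trace_eq_of_adjoint {x : M} {a a' : TangentSpace I x →ₗ[ℝ] TangentSpace I x}
    (h : ∀ u v, g.inner x (a u) v = g.inner x u (a' v)) :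
    LinearMap.trace ℝ _ a = LinearMap.trace ℝ _ a' := by
  obtain ⟨e, θ, he⟩ := exists_dual_frame g x
  have hx := he.self_of_nhds.2
  have hx' (v : TangentSpace I x) : v = ∑ i, g.inner x v (e i x) • θ i x := by
    refine eq_of_inner_eq g fun w => ?_
    conv_lhs => rw [hx w]
    simp [g.symm x w, mul_comm]
  rw [trace_eq_sum_of_dual g hx, trace_eq_sum_of_dual g hx']
  exact Finset.sum_congr rfl fun i _ => by rw [h, g.symm]

theorem trace_eventuallyEq (A : VField I M → VField I M)
    (a : Π p : M, TangentSpace I p →ₗ[ℝ] TangentSpace I p) (hA : ∀ X p, A X p = a p (X p))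
    {ι : Type*} [Fintype ι] {e θ : ι → VField I M} {x : M}
    (he : ∀ᶠ p in 𝓝 x, ∀ v : TangentSpace I p, v = ∑ i, g.inner p v (θ i p) • e i p) :
    (fun p => LinearMap.trace ℝ _ (a p)) =ᶠ[𝓝 x]
      (∑ i, VField.inn g (A (e i)) (θ i) : Fn I M) := by
  filter_upwards [he] with p hp
  rw [trace_eq_sum_of_dual g hp (a p), Fn.sum_apply]
  exact Finset.sum_congr rfl fun i _ => by rw [VField.inn_apply, hA]

theorem mdiffAt_trace (g : ContMDiffRiemannianMetric I ∞ E (fun x : M => TangentSpace I x))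
    (A : VField I M → VField I M)
    (a : Π p : M, TangentSpace I p →ₗ[ℝ] TangentSpace I p) (hA : ∀ X p, A X p = a p (X p))
    (x : M) : MDiffAt (fun p => LinearMap.trace ℝ _ (a p)) x := by
  obtain ⟨e, θ, he⟩ := exists_dual_frame g x
  exact (Fn.mdiffAt _ x).congr_of_eventuallyEq
    (trace_eventuallyEq g A a hA (he.mono fun p hp => hp.2))

/-- The derivative of the trace of a smooth endomorphism field along `W` is the trace of its Lie
derivative. -/
theorem mvfderiv_trace (g : ContMDiffRiemannianMetric I ∞ E (fun x : M => TangentSpace I x))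
    (W : VField I M) (A : VField I M → VField I M)
    (a : Π p : M, TangentSpace I p →ₗ[ℝ] TangentSpace I p) (hA : ∀ X p, A X p = a p (X p))
    (x : M) (T : TangentSpace I x →ₗ[ℝ] TangentSpace I x)
    (hT : ∀ X : VField I M, T (X x) = W.bracket (A X) x - a x (W.bracket X x)) :
    mvfderiv I (fun p => LinearMap.trace ℝ _ (a p)) x (W x) = LinearMap.trace ℝ _ T := by
  obtain ⟨e, θ, he⟩ := exists_dual_frame g x
  have hx := he.self_of_nhds
  have h1 : (fun p => LinearMap.trace ℝ _ (a p)) =ᶠ[𝓝 x]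
      (∑ i, VField.inn g (A (e i)) (θ i) : Fn I M) :=
    trace_eventuallyEq g A a hA (he.mono fun p hp => hp.2)
  have h2 : mvfderiv I (fun p => LinearMap.trace ℝ _ (a p)) x (W x) =
      ∑ i, W.der (VField.inn g (A (e i)) (θ i)) x := by
    have : mvfderiv I (fun p => LinearMap.trace ℝ _ (a p)) x =
        mvfderiv I (∑ i, VField.inn g (A (e i)) (θ i) : Fn I M) x := by
      unfold mvfderiv
      rw [h1.mfderiv_eq]
      rfl
    rw [this, ← VField.der_apply]
    have hsum : W.der (∑ i, VField.inn g (A (e i)) (θ i)) =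
        ∑ i, W.der (VField.inn g (A (e i)) (θ i)) :=
      map_sum (AddMonoidHom.mk' W.der (W.der_add)) _ _
    rw [hsum, Fn.sum_apply]
  -- Bracket `W` with `Z = ∑ g(Z, θ_i) e_i` and pair with `θ_j`: the derivatives of the coefficients
  -- are isolated without differentiating `θ`.
  have h3 (Z : VField I M) (j) : W.der (VField.inn g Z (θ j)) x =
      g.inner x (W.bracket Z x) (θ j x) -
        ∑ i, g.inner x (Z x) (θ i x) * g.inner x (W.bracket (e i) x) (θ j x) := by
    have hZ : W.bracket Z x = W.bracket (∑ i, VField.inn g Z (θ i) • e i) x := by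
      refine (EventuallyEq.refl _ _).mlieBracket_vectorField_eq ?_
      filter_upwards [he] with p hp
      rw [VField.sum_apply]
      exact hp.2 (Z p)
    have hsum : W.bracket (∑ i, VField.inn g Z (θ i) • e i) =
        ∑ i, W.bracket (VField.inn g Z (θ i) • e i) :=
      map_sum (AddMonoidHom.mk' W.bracket (W.bracket_add_right)) _ _
    rw [hsum, VField.sum_apply] at hZ
    simp only [VField.bracket_smul_right, VField.add_apply, VField.fsmul_apply] at hZ
    rw [hZ, map_sum, sum_apply]
    simp only [map_add, map_smul, add_apply, smul_apply, hx.1, VField.inn_apply, smul_eq_mul,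
      Finset.sum_add_distrib]
    simp
  rw [h2, trace_eq_sum_of_dual g hx.2 T]
  have h4 (j) : g.inner x (a x (W.bracket (e j) x)) (θ j x) =
      ∑ i, g.inner x (W.bracket (e j) x) (θ i x) * g.inner x (A (e i) x) (θ j x) := by
    conv_lhs => rw [hx.2 (W.bracket (e j) x)]
    simp [hA]
  -- The terms caused by the motion of the frame form the trace of a product of two matrices, and
  -- `a(W.bracket e_j)` gives the trace of the product in the other order.
  simp only [h3, hT, map_sub, sub_apply, h4, Finset.sum_sub_distrib]
  congr 1
  rw [Finset.sum_comm]
  exact Finset.sum_congr rfl fun i _ => Finset.sum_congr rfl fun j _ => mul_comm _ _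

end Frames

end WeakMetric

end

/-! ### Pure algebra: curvature and Lie derivatives of a Kenmotsu structure over a ring of
functions. -/

noncomputable section

namespace WeakMetric

/-- A torsion-free metric connection on a module `𝔛` of "vector fields" over a ring `A` of
"functions". -/
structure MetricConnection (A 𝔛 : Type*) [CommRing A] [AddCommGroup 𝔛] [Module A 𝔛] where
  der : 𝔛 →ₗ[A] Derivation ℤ A A
  inn : 𝔛 →ₗ[A] 𝔛 →ₗ[A] A
  nab : 𝔛 →ₗ[A] 𝔛 →+ 𝔛
  two_cancel : ∀ a : A, a + a = 0 → a = 0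
  inn_comm : ∀ X Y, inn X Y = inn Y X
  nondegenerate : ∀ X, (∀ Y, inn X Y = 0) → X = 0
  nab_smul : ∀ X (a : A) Y, nab X (a • Y) = a • nab X Y + der X a • Y
  der_inn : ∀ X Y Z, der X (inn Y Z) = inn (nab X Y) Z + inn Y (nab X Z)
  der_bracket : ∀ X Y a, der (nab X Y - nab Y X) a = der X (der Y a) - der Y (der X a)
  jacobi : ∀ X Y Z, (nab X (nab Y Z - nab Z Y) - nab (nab Y Z - nab Z Y) X) =
    (nab (nab X Y - nab Y X) Z - nab Z (nab X Y - nab Y X)) +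
    (nab Y (nab X Z - nab Z X) - nab (nab X Z - nab Z X) Y)

namespace MetricConnection

variable {A 𝔛 : Type*} [CommRing A] [AddCommGroup 𝔛] [Module A 𝔛] (C : MetricConnection A 𝔛)

/-- The Lie bracket. -/
def br (X Y : 𝔛) : 𝔛 := C.nab X Y - C.nab Y X

/-- The curvature. -/
def R (X Y Z : 𝔛) : 𝔛 := C.nab X (C.nab Y Z) - C.nab Y (C.nab X Z) - C.nab (C.br X Y) Z

theorem R_swap (X Y Z : 𝔛) : C.R X Y Z = - C.R Y X Z := by
  simp only [R, br, map_sub, AddMonoidHom.sub_apply]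
  abel

theorem R_bianchi (X Y Z : 𝔛) : C.R X Y Z + C.R Y Z X + C.R Z X Y = 0 := by
  have h := C.jacobi X Y Z
  simp only [map_sub, AddMonoidHom.sub_apply] at h
  simp only [R, br, map_sub, AddMonoidHom.sub_apply]
  linear_combination (norm := module) (1 : ℤ) • h

theorem inn_R_skew (X Y Z W : 𝔛) : C.inn (C.R X Y Z) W = - C.inn (C.R X Y W) Z := by
  have h := C.der_bracket X Y (C.inn Z W)
  simp only [C.der_inn, map_add] at h
  simp only [R, br, map_sub, LinearMap.sub_apply, AddMonoidHom.sub_apply] at h ⊢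
  rw [C.inn_comm (C.nab X (C.nab Y W)), C.inn_comm (C.nab Y (C.nab X W)),
    C.inn_comm (C.nab (C.nab X Y) W), C.inn_comm (C.nab (C.nab Y X) W)]
  linear_combination -h

/-- The classical octahedron argument: four Bianchi identities and the two skew symmetries give
twice the difference, so the ring must have no 2-torsion. -/
theorem inn_R_pair (X Y Z W : 𝔛) : C.inn (C.R X Y Z) W = C.inn (C.R Z W X) Y := by
  have b (X Y Z W : 𝔛) : C.inn (C.R X Y Z) W + C.inn (C.R Y Z X) W + C.inn (C.R Z X Y) W = 0 := by
    simpa using congrArg (fun V => C.inn V W) (C.R_bianchi X Y Z)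
  have sw (X Y Z W : 𝔛) : C.inn (C.R X Y Z) W = - C.inn (C.R Y X Z) W := by
    rw [C.R_swap]; simp
  have sk := C.inn_R_skew
  refine sub_eq_zero.1 (C.two_cancel _ ?_)
  have b1 := b Z X Y W
  have b2 := b X Y W Z
  have b3 := b Y W Z X
  have b4 := b W Z X Y
  grind

theorem eq_of_inn_eq {X Y : 𝔛} (h : ∀ Z, C.inn X Z = C.inn Y Z) : X = Y :=
  sub_eq_zero.1 (C.nondegenerate _ fun Z => by simp [h])

end MetricConnection

/-- A weak `β f`-Kenmotsu structure, expressed on vector fields. -/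
structure KenmotsuAlgebra (A 𝔛 ι : Type*) [CommRing A] [AddCommGroup 𝔛] [Module A 𝔛]
    [Fintype ι] [DecidableEq ι] extends MetricConnection A 𝔛 where
  f : 𝔛 →ₗ[A] 𝔛
  ξ : ι → 𝔛
  β : A
  der_β : ∀ X, der X β = 0
  inn_ξ_ξ : ∀ i j, inn (ξ i) (ξ j) = if i = j then 1 else 0
  f_ξ : ∀ i, f (ξ i) = 0
  f_skew : ∀ X Y, inn (f X) Y = - inn X (f Y)
  nab_ξ : ∀ X i, nab X (ξ i) = β • (X - ∑ j, inn (ξ j) X • ξ j)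
  nab_f : ∀ X Y, nab X (f Y) = f (nab X Y) +
    β • (inn (f X) Y • ∑ j, ξ j - inn (∑ j, ξ j) Y • f X)

namespace KenmotsuAlgebra

variable {A 𝔛 ι : Type*} [CommRing A] [AddCommGroup 𝔛] [Module A 𝔛]
    [Fintype ι] [DecidableEq ι] (K : KenmotsuAlgebra A 𝔛 ι)

/-- `ξ̄ = ∑ ξ_i` -/
def ξb : 𝔛 := ∑ j, K.ξ j

/-- The projection onto the contact distribution. -/
def P : 𝔛 →ₗ[A] 𝔛 := LinearMap.id - ∑ j, (K.inn (K.ξ j)).smulRight (K.ξ j)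

theorem P_apply (X : 𝔛) : K.P X = X - ∑ j, K.inn (K.ξ j) X • K.ξ j := by
  simp [P]

theorem nab_ξ' (X : 𝔛) (i : ι) : K.nab X (K.ξ i) = K.β • K.P X := by
  rw [K.nab_ξ, P_apply]

theorem nab_ξb (X : 𝔛) : K.nab X K.ξb = ((Fintype.card ι : A) * K.β) • K.P X := by
  simp only [ξb, map_sum, nab_ξ', Finset.sum_const, Finset.card_univ]
  rw [mul_smul, Nat.cast_smul_eq_nsmul]

theorem nab_f' (X Y : 𝔛) : K.nab X (K.f Y) = K.f (K.nab X Y) +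
    (K.β * K.inn (K.f X) Y) • K.ξb - (K.β * K.inn K.ξb Y) • K.f X := by
  rw [K.nab_f]
  change _ + K.β • (_ • K.ξb - _) = _
  rw [ξb]
  module

theorem P_ξ (i : ι) : K.P (K.ξ i) = 0 := by
  simp [P_apply, K.inn_ξ_ξ]

theorem inn_ξ_f (i : ι) (X : 𝔛) : K.inn (K.ξ i) (K.f X) = 0 := by
  have := K.f_skew (K.ξ i) X
  simpa [K.f_ξ] using this

theorem inn_ξb_f (X : 𝔛) : K.inn K.ξb (K.f X) = 0 := by
  simp [ξb, inn_ξ_f]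

theorem P_f (X : 𝔛) : K.P (K.f X) = K.f X := by
  simp [P_apply, inn_ξ_f]

theorem f_P (X : 𝔛) : K.f (K.P X) = K.f X := by
  simp [P_apply, K.f_ξ]

theorem inn_P (X Y : 𝔛) : K.inn (K.P X) Y = K.inn X (K.P Y) := by
  simp only [P_apply, map_sub, LinearMap.sub_apply, map_sum, LinearMap.sum_apply, map_smul,
    LinearMap.smul_apply, smul_eq_mul]
  congr 1
  exact Finset.sum_congr rfl fun i _ => by rw [K.inn_comm X (K.ξ i)]; ring

theorem inn_ξ_P (i : ι) (X : 𝔛) : K.inn (K.ξ i) (K.P X) = 0 := by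
  simp [← inn_P, P_ξ]

theorem P_P (X : 𝔛) : K.P (K.P X) = K.P X := by
  conv_lhs => rw [P_apply]
  simp [inn_ξ_P]

theorem nab_β_smul (X Y : 𝔛) : K.nab X (K.β • Y) = K.β • K.nab X Y := by
  rw [K.nab_smul, K.der_β]; simp

theorem nab_P (X Y : 𝔛) : K.nab X (K.P Y) = K.P (K.nab X Y) -
    (K.β * K.inn (K.P X) Y) • K.ξb - (K.β * K.inn K.ξb Y) • K.P X := by
  have h (j : ι) : K.nab X (K.inn (K.ξ j) Y • K.ξ j) = K.inn (K.ξ j) (K.nab X Y) • K.ξ j +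
      (K.β * K.inn (K.P X) Y) • K.ξ j + (K.β * K.inn (K.ξ j) Y) • K.P X := by
    rw [K.nab_smul, K.nab_ξ', K.der_inn, K.nab_ξ']
    simp only [map_smul, LinearMap.smul_apply, smul_eq_mul]
    module
  conv_lhs => rw [P_apply]
  rw [map_sub, map_sum]
  simp only [h, Finset.sum_add_distrib, ← Finset.smul_sum, ← Finset.sum_smul, ← Finset.mul_sum]
  rw [P_apply K (K.nab X Y)]
  have e : K.inn K.ξb Y = ∑ j, K.inn (K.ξ j) Y := by simp [ξb]
  rw [e, ξb]
  module

theorem R_ξ (X Y : 𝔛) (i : ι) : K.R X Y (K.ξ i) =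
    (K.β * K.β) • (K.inn K.ξb X • K.P Y - K.inn K.ξb Y • K.P X) := by
  simp only [MetricConnection.R, MetricConnection.br, nab_ξ', nab_β_smul, nab_P, map_sub,
    AddMonoidHom.sub_apply]
  have h : K.inn (K.P X) Y = K.inn (K.P Y) X := by rw [inn_P, K.inn_comm]
  rw [h]
  module

/-- Pair symmetry turns `g(R_{ξ_i,X} Y, Z)` into `g(R_{Y,Z} ξ_i, X)`, known from `R_ξ`. -/
theorem R_ξ_left (i : ι) (X Y : 𝔛) : K.R (K.ξ i) X Y =
    (K.β * K.β) • (K.inn K.ξb Y • K.P X - K.inn (K.P X) Y • K.ξb) := by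
  refine K.eq_of_inn_eq fun Z => ?_
  have h1 : K.inn (K.P Z) X = K.inn (K.P X) Z := by rw [inn_P, K.inn_comm]
  have h2 : K.inn (K.P Y) X = K.inn (K.P X) Y := by rw [inn_P, K.inn_comm]
  rw [K.inn_R_pair, R_ξ]
  simp only [map_smul, map_sub, LinearMap.smul_apply, LinearMap.sub_apply, smul_eq_mul, h1, h2]
  ring

/-- The Ricci identity for `f`: antisymmetrize the second covariant derivative of `f`, obtained by
differentiating the Kenmotsu formula again. The factor `s` enters through `∇_X ξ̄ = sβ PX`. -/
theorem R_f (X Y Z : 𝔛) : K.R X Y (K.f Z) = K.f (K.R X Y Z) + (K.β * K.β) •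
    ((K.inn K.ξb X * K.inn (K.f Y) Z - K.inn K.ξb Y * K.inn (K.f X) Z) • K.ξb
    + ((Fintype.card ι : A) * K.inn (K.f Y) Z) • K.P X
    - ((Fintype.card ι : A) * K.inn (K.f X) Z) • K.P Y
    - ((Fintype.card ι : A) * K.inn (K.P X) Z) • K.f Y
    + ((Fintype.card ι : A) * K.inn (K.P Y) Z) • K.f X
    + K.inn K.ξb Z • (K.inn K.ξb Y • K.f X - K.inn K.ξb X • K.f Y)) := by
  have h : K.inn (K.f X) Y = - K.inn (K.f Y) X := by rw [K.f_skew, K.inn_comm]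
  simp only [MetricConnection.R, MetricConnection.br, nab_f', map_sub, map_add, map_smul,
    AddMonoidHom.sub_apply, K.nab_smul, nab_ξb, Derivation.leibniz, K.der_β, K.der_inn,
    LinearMap.add_apply, LinearMap.sub_apply, LinearMap.smul_apply, smul_eq_mul]
  rw [h]
  module

/-- The Lie derivative of the connection along `ξ_i`. -/
theorem br_ξ_nab (i : ι) (X Y : 𝔛) : K.br (K.ξ i) (K.nab X Y) = K.nab (K.br (K.ξ i) X) Y +
    K.nab X (K.br (K.ξ i) Y) - (2 * (K.β * K.β) * K.inn (K.P X) Y) • K.ξb := by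
  -- The Lie derivative of `∇` along `ξ_i` is `R_{ξ_i,X} Y` plus the second covariant derivative of
  -- `ξ_i`; both are known.
  have h := K.R_ξ_left i X Y
  simp only [MetricConnection.R, MetricConnection.br, map_sub, AddMonoidHom.sub_apply] at h
  simp only [MetricConnection.br, nab_ξ', nab_β_smul, nab_P, map_sub, AddMonoidHom.sub_apply] at h ⊢
  linear_combination (norm := module) (1 : ℤ) • h

/-- The Kenmotsu correction to `∇_{ξ_i} f` vanishes since `f ξ_i = 0`, and `∇ξ_i = βP` commutes with
`f`. -/
theorem br_ξ_f (i : ι) (X : 𝔛) : K.br (K.ξ i) (K.f X) = K.f (K.br (K.ξ i) X) := by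
  simp [MetricConnection.br, nab_f', nab_ξ', K.f_ξ, P_f, f_P]

theorem br_br (X Y Z : 𝔛) : K.br X (K.br Y Z) = K.br (K.br X Y) Z + K.br Y (K.br X Z) := 
  K.jacobi X Y Z

/-- The Lie derivative of the curvature along `ξ_i`. -/
theorem br_ξ_R (i : ι) (X Y Z : 𝔛) : K.br (K.ξ i) (K.R X Y Z) =
    K.R (K.br (K.ξ i) X) Y Z + K.R X (K.br (K.ξ i) Y) Z + K.R X Y (K.br (K.ξ i) Z)
    - (2 * (K.β * K.β * K.β)) • 
    ((K.inn (K.P Y) Z * K.inn K.ξb X - K.inn (K.P X) Z * K.inn K.ξb Y) • K.ξb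
    + ((Fintype.card ι : A) * K.inn (K.P Y) Z) • K.P X
    - ((Fintype.card ι : A) * K.inn (K.P X) Z) • K.P Y) := by
  have hs (X Y : 𝔛) : K.br (K.ξ i) (X - Y) = K.br (K.ξ i) X - K.br (K.ξ i) Y := by
    simp only [MetricConnection.br, map_sub, AddMonoidHom.sub_apply]
    module
  have h2 : K.der X (2 : A) = 0 := by exact_mod_cast (K.der X).map_natCast 2
  have h2' : K.der Y (2 : A) = 0 := by exact_mod_cast (K.der Y).map_natCast 2
  have h : K.inn (K.P X) Y = K.inn (K.P Y) X := by rw [inn_P, K.inn_comm]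
  -- The bracket is moved through every `∇` in `R`. Each crossing costs a term `2β² g(P·,·) ξ̄`; the
  -- antisymmetrized covariant derivative of that tensor is the correction.
  conv_lhs => rw [MetricConnection.R, hs, hs, br_ξ_nab, br_ξ_nab, br_ξ_nab, br_ξ_nab, br_ξ_nab, br_br]
  simp only [map_sub, map_add, K.nab_smul, nab_ξb, Derivation.leibniz, K.der_β, h2, h2', K.der_inn,
    nab_P, smul_eq_mul, LinearMap.sub_apply, LinearMap.smul_apply, map_smul, 
    MetricConnection.R, AddMonoidHom.add_apply]
  rw [show K.br X Y = K.nab X Y - K.nab Y X from rfl]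
  simp only [map_sub, LinearMap.sub_apply]
  rw [h]
  module

theorem der_ξ_inn (i : ι) (X Y : 𝔛) : K.der (K.ξ i) (K.inn X Y) =
    K.inn (K.br (K.ξ i) X) Y + K.inn X (K.br (K.ξ i) Y) + 2 * K.β * K.inn (K.P X) Y := by
  simp only [K.der_inn, MetricConnection.br, nab_ξ', map_sub, LinearMap.sub_apply, map_smul,
    LinearMap.smul_apply, smul_eq_mul, inn_P]
  ring

end KenmotsuAlgebra

end WeakMetric

end

/-! ### The curvature as a tensor at a point. -/

noncomputable section

namespace WeakMetric

open Filter
open scoped Topology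

section Curvature

set_option linter.unusedSectionVars false

variable {E : Type*} [NormedAddCommGroup E] [NormedSpace ℝ E] [FiniteDimensional ℝ E]
  {H : Type*} [TopologicalSpace H] {I : ModelWithCorners ℝ E H}
  {M : Type*} [TopologicalSpace M] [ChartedSpace H M] [IsManifold I ∞ M] [T2Space M]
  (g : ContMDiffRiemannianMetric I ∞ E (fun x : M => TangentSpace I x))

/-- The Levi-Civita connection on smooth vector fields. -/
def connection : MetricConnection (Fn I M) (VField I M) where
  der :=
    { toFun X := Derivation.mk' (AddMonoidHom.mk' X.der X.der_add).toIntLinearMap X.der_mul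
      map_add' X Y := Derivation.ext (VField.der_add_left X Y)
      map_smul' h X := Derivation.ext (VField.der_smul_left h X) }
  inn := LinearMap.mk₂ (Fn I M) (VField.inn g)
    (fun X Y Z => by ext x; simp [VField.inn_apply])
    (fun h X Y => by ext x; simp [VField.inn_apply, VField.fsmul_apply])
    (fun X Y Z => by ext x; simp [VField.inn_apply])
    (fun h X Y => by ext x; simp [VField.inn_apply, VField.fsmul_apply])
  nab :=
    { toFun X := AddMonoidHom.mk' (VField.nab g X) (VField.nab_add_right g X)
      map_add' X Y := AddMonoidHom.ext (VField.nab_add_left g X Y)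
      map_smul' h X := AddMonoidHom.ext (VField.nab_smul_left g h X) }
  two_cancel a ha := by
    ext x
    have := congrArg (fun h : Fn I M => h x) ha
    simpa using this
  inn_comm := VField.inn_comm g
  nondegenerate X hX := by
    ext x
    by_contra h
    exact (g.pos x _ h).ne' (congrArg (fun h : Fn I M => h x) (hX X))
  nab_smul X a Y := VField.nab_smul_right g a X Y
  der_inn := VField.der_inn g
  der_bracket X Y a := by
    have := VField.der_bracket X Y a
    rw [VField.bracket_eq g] at this
    exact this
  jacobi X Y Z := by
    have := VField.jacobi X Y Z
    simp only [VField.bracket_eq g] at this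
    exact this

theorem connection_inn (X Y : VField I M) (x : M) :
    (connection g).inn X Y x = g.inner x (X x) (Y x) := rfl

theorem connection_br (X Y : VField I M) : (connection g).br X Y = X.bracket Y :=
  (VField.bracket_eq g X Y).symm

theorem connection_R (X Y Z : VField I M) (x : M) :
    (connection g).R X Y Z x = curvature g X Y Z x := by
  rw [MetricConnection.R, connection_br]
  rfl

/-- `∇` depends only on germs; this carries `curvatureAt`, defined with local extensions, over to
global fields. -/
theorem nabla_eventuallyEq {X Y : Π p : M, TangentSpace I p} {X' Y' : VField I M} {x : M}
    (hX : ∀ᶠ p in 𝓝 x, X' p = X p) (hY : ∀ᶠ p in 𝓝 x, Y' p = Y p) :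
    ∀ᶠ p in 𝓝 x, VField.nab g X' Y' p = nabla g X Y p := by
  filter_upwards [hX, hY.eventually_nhds] with p hXp hYp
  have hYd : MDiffAt (T% Y) p := (Y'.mdiffAt p).congr_of_eventuallyEq
    (hYp.mono fun q hq => congrArg (TotalSpace.mk' E q) hq.symm)
  change leviCivita g Y' p (X' p) = leviCivita g Y p (X p)
  rw [hXp]
  exact congrArg (fun l => l (X p)) ((leviCivita g).isCovariantDerivativeOnUniv.congr_of_eventuallyEq
    (Y'.mdiffAt p) hYd univ_mem hYp)

/-- Pointwise dependence comes from the symmetries. Skewness moves the third argument into the outer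
slot of an inner product, where only its value matters; pair symmetry then treats the first
argument, and the swap treats the second. -/
theorem R_apply_congr {X X' Y Y' Z Z' : VField I M} {x : M} (hX : X x = X' x) (hY : Y x = Y' x)
    (hZ : Z x = Z' x) : (connection g).R X Y Z x = (connection g).R X' Y' Z' x := by
  have third {X Y Z Z' : VField I M} (h : Z x = Z' x) :
      (connection g).R X Y Z x = (connection g).R X Y Z' x := by
    refine eq_of_inner_eq g fun w => ?_
    have h1 := congrArg (fun h : Fn I M => h x)
      ((connection g).inn_R_skew X Y Z (VField.through x w))
    have h2 := congrArg (fun h : Fn I M => h x)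
      ((connection g).inn_R_skew X Y Z' (VField.through x w))
    simp only [ContMDiffMap.coe_neg, Pi.neg_apply, connection_inn, VField.through_apply] at h1 h2
    rw [h1, h2, h]
  have first {X X' Y Z : VField I M} (h : X x = X' x) :
      (connection g).R X Y Z x = (connection g).R X' Y Z x := by
    refine eq_of_inner_eq g fun w => ?_
    have h1 := congrArg (fun h : Fn I M => h x)
      ((connection g).inn_R_pair X Y Z (VField.through x w))
    have h2 := congrArg (fun h : Fn I M => h x)
      ((connection g).inn_R_pair X' Y Z (VField.through x w))
    simp only [connection_inn, VField.through_apply] at h1 h2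
    rw [h1, h2, third h]
  rw [first hX, third hZ, (connection g).R_swap, (connection g).R_swap X', VField.neg_apply,
    VField.neg_apply, first hY]

theorem curvatureAt_apply (X Y Z : VField I M) (x : M) :
    curvatureAt g x (X x) (Y x) (Z x) = (connection g).R X Y Z x := by
  obtain ⟨X', hX⟩ := exists_vfield_eventuallyEq_extend (X x)
  obtain ⟨Y', hY⟩ := exists_vfield_eventuallyEq_extend (Y x)
  obtain ⟨Z', hZ⟩ := exists_vfield_eventuallyEq_extend (Z x)
  have hX0 : X' x = X x := by simpa using hX.self_of_nhds
  have hY0 : Y' x = Y x := by simpa using hY.self_of_nhds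
  have hZ0 : Z' x = Z x := by simpa using hZ.self_of_nhds
  rw [R_apply_congr g hX0.symm hY0.symm hZ0.symm, connection_R, curvatureAt]
  have hb : ∀ᶠ p in 𝓝 x, X'.bracket Y' p = mlieBracket I (extend E (X x)) (extend E (Y x)) p :=
    EventuallyEq.mlieBracket_vectorField hX hY
  have h1 := (nabla_eventuallyEq g hX (nabla_eventuallyEq g hY hZ)).self_of_nhds
  have h2 := (nabla_eventuallyEq g hY (nabla_eventuallyEq g hX hZ)).self_of_nhds
  have h3 := (nabla_eventuallyEq g hb hZ).self_of_nhds
  simp only [curvature]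
  rw [← h1, ← h2, ← h3]
  rfl

theorem curvatureAt_eq (x : M) (u v w : TangentSpace I x) :
    curvatureAt g x u v w =
      (connection g).R (VField.through x u) (VField.through x v) (VField.through x w) x := by
  rw [← curvatureAt_apply]
  simp

theorem curvatureAt_swap (x : M) (u v w : TangentSpace I x) :
    curvatureAt g x u v w = - curvatureAt g x v u w := by
  rw [curvatureAt_eq, (connection g).R_swap, curvatureAt_eq]
  rfl

theorem curvatureAt_bianchi (x : M) (u v w : TangentSpace I x) :
    curvatureAt g x u v w + curvatureAt g x v w u + curvatureAt g x w u v = 0 := by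
  simp only [curvatureAt_eq]
  exact congrArg (fun X : VField I M => X x) ((connection g).R_bianchi _ _ _)

theorem inner_curvatureAt_skew (x : M) (u v w z : TangentSpace I x) :
    g.inner x (curvatureAt g x u v w) z = - g.inner x (curvatureAt g x u v z) w := by
  have := congrArg (fun h : Fn I M => h x) ((connection g).inn_R_skew
    (VField.through x u) (VField.through x v) (VField.through x w) (VField.through x z))
  simpa only [ContMDiffMap.coe_neg, Pi.neg_apply, connection_inn, ← curvatureAt_eq,
    VField.through_apply] using this

theorem inner_curvatureAt_pair (x : M) (u v w z : TangentSpace I x) :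
    g.inner x (curvatureAt g x u v w) z = g.inner x (curvatureAt g x w z u) v := by
  have := congrArg (fun h : Fn I M => h x) ((connection g).inn_R_pair
    (VField.through x u) (VField.through x v) (VField.through x w) (VField.through x z))
  simpa only [connection_inn, ← curvatureAt_eq, VField.through_apply] using this

theorem curvatureAt_add_right (x : M) (u v w w' : TangentSpace I x) :
    curvatureAt g x u v (w + w') = curvatureAt g x u v w + curvatureAt g x u v w' := by
  refine eq_of_inner_eq g fun z => ?_
  rw [inner_curvatureAt_skew, map_add, map_add, add_apply, inner_curvatureAt_skew g x u v w,
    inner_curvatureAt_skew g x u v w', neg_add]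

theorem curvatureAt_smul_right (x : M) (c : ℝ) (u v w : TangentSpace I x) :
    curvatureAt g x u v (c • w) = c • curvatureAt g x u v w := by
  refine eq_of_inner_eq g fun z => ?_
  rw [inner_curvatureAt_skew, map_smul, map_smul, smul_apply, inner_curvatureAt_skew g x u v w,
    smul_neg]

theorem curvatureAt_add_left (x : M) (u u' v w : TangentSpace I x) :
    curvatureAt g x (u + u') v w = curvatureAt g x u v w + curvatureAt g x u' v w := by
  refine eq_of_inner_eq g fun z => ?_
  rw [inner_curvatureAt_pair, curvatureAt_add_right, map_add, add_apply, map_add, add_apply,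
    inner_curvatureAt_pair g x u, inner_curvatureAt_pair g x u']

theorem curvatureAt_smul_left (x : M) (c : ℝ) (u v w : TangentSpace I x) :
    curvatureAt g x (c • u) v w = c • curvatureAt g x u v w := by
  refine eq_of_inner_eq g fun z => ?_
  rw [inner_curvatureAt_pair, curvatureAt_smul_right, map_smul, smul_apply, map_smul, smul_apply,
    inner_curvatureAt_pair g x u]

/-- The curvature tensor at a point as a trilinear map. -/
def curvatureTensor (x : M) : TangentSpace I x →ₗ[ℝ] TangentSpace I x →ₗ[ℝ]
    TangentSpace I x →ₗ[ℝ] TangentSpace I x :=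
  LinearMap.mk₂ ℝ
    (fun u v =>
      { toFun := curvatureAt g x u v
        map_add' := curvatureAt_add_right g x u v
        map_smul' := fun c => curvatureAt_smul_right g x c u v })
    (fun u u' v => LinearMap.ext fun w => curvatureAt_add_left g x u u' v w)
    (fun c u v => LinearMap.ext fun w => curvatureAt_smul_left g x c u v w)
    (fun u v v' => LinearMap.ext fun w => by
      change curvatureAt g x u (v + v') w = curvatureAt g x u v w + curvatureAt g x u v' w
      rw [curvatureAt_swap, curvatureAt_add_left, curvatureAt_swap g x u, curvatureAt_swap g x u v',
        neg_add])
    (fun c u v => LinearMap.ext fun w => by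
      change curvatureAt g x u (c • v) w = c • curvatureAt g x u v w
      rw [curvatureAt_swap, curvatureAt_smul_left, curvatureAt_swap g x u, smul_neg])

theorem curvatureTensor_apply (x : M) (u v w : TangentSpace I x) :
    curvatureTensor g x u v w = curvatureAt g x u v w := rfl

end Curvature

end WeakMetric

end

/-! ### From the normal weak Kenmotsu structure to `∇_X ξ_i = β PX`. -/

noncomputable section

namespace WeakMetric

namespace MetricConnection

variable {A 𝔛 ι : Type*} [CommRing A] [AddCommGroup 𝔛] [Module A 𝔛] [Fintype ι] [DecidableEq ι]
  (C : MetricConnection A 𝔛)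

/-- The Nijenhuis torsion of `f` vanishes when `∇f` has the Kenmotsu form. -/
theorem nijenhuis_eq_zero (f : 𝔛 →ₗ[A] 𝔛) (f_skew : ∀ X Y, C.inn (f X) Y = - C.inn X (f Y))
    (β : A) (ξb : 𝔛) (f_ξb : f ξb = 0)
    (nab_f : ∀ X Y, C.nab X (f Y) = f (C.nab X Y) +
      β • (C.inn (f X) Y • ξb - C.inn ξb Y • f X)) (X Y : 𝔛) :
    f (f (C.br X Y)) + C.br (f X) (f Y) - f (C.br (f X) Y) - f (C.br X (f Y)) = 0 := by
  have h1 : C.inn ξb (f X) = 0 := by simpa [f_ξb] using f_skew ξb X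
  have h2 : C.inn ξb (f Y) = 0 := by simpa [f_ξb] using f_skew ξb Y
  have h3 : C.inn (f (f X)) Y = C.inn (f (f Y)) X := by
    rw [f_skew, f_skew, neg_neg, C.inn_comm]
  simp only [br, nab_f, map_add, map_sub, map_smul, f_ξb, h3]
  module

/-- Orthonormal fields with closed dual forms for which `∇_X ξ_i - β X` lies in the span of the
`ξ_j` have no normal connection. -/
theorem inn_nab_eq_zero (ξ : ι → 𝔛) (β : A)
    (orth : ∀ i j, C.inn (ξ i) (ξ j) = if i = j then 1 else 0)
    (closed : ∀ i X Y, C.inn (C.nab X (ξ i)) Y = C.inn (C.nab Y (ξ i)) X)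
    (span : ∀ i X, C.nab X (ξ i) - β • X = ∑ j, C.inn (ξ j) (C.nab X (ξ i) - β • X) • ξ j)
    (i j : ι) (X : 𝔛) : C.inn (C.nab X (ξ i)) (ξ j) = 0 := by
  have anti (i j : ι) (X : 𝔛) : C.inn (C.nab X (ξ i)) (ξ j) = - C.inn (C.nab X (ξ j)) (ξ i) := by
    have h := C.der_inn X (ξ i) (ξ j)
    have h0 : C.der X (C.inn (ξ i) (ξ j)) = 0 := by
      rw [orth]
      split_ifs
      · exact (C.der X).map_one_eq_zero
      · exact map_zero _
    rw [h0, C.inn_comm (ξ i)] at h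
    linear_combination -h
  -- `T(i, j, k) = g(∇_{ξ_j} ξ_i, ξ_k)` is symmetric in `j, k` and antisymmetric in `i, k`.
  -- Alternating the two symmetries around a full cycle gives `T = -T`.
  have hc (i j k : ι) : C.inn (C.nab (ξ j) (ξ i)) (ξ k) = 0 := by
    refine C.two_cancel _ ?_
    linear_combination closed i (ξ j) (ξ k) + anti i j (ξ k) - closed j (ξ k) (ξ i)
      - anti j k (ξ i) + closed k (ξ i) (ξ j) + anti i k (ξ j)
  have h0 : C.nab (ξ j) (ξ i) = 0 := by
    have h := span i (ξ j)
    simp only [map_sub, map_smul, C.inn_comm (ξ _) (C.nab _ _), hc, orth, sub_smul,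
      smul_eq_mul, mul_ite, mul_one, mul_zero, ite_smul, zero_smul, Finset.sum_sub_distrib,
      Finset.sum_const_zero, Finset.sum_ite_eq', Finset.mem_univ, if_true] at h
    linear_combination (norm := module) (1 : ℤ) • h
  rw [closed, h0]
  simp

end MetricConnection

namespace WeakMetricFStructure

set_option linter.unusedSectionVars false

variable {n s : ℕ} {M : Type*} [TopologicalSpace M] [T2Space M]
  [ChartedSpace (EuclideanSpace ℝ (Fin (2 * n + s))) M]
  [IsManifold (𝓡 (2 * n + s)) ∞ M] (S : WeakMetricFStructure n s M)

/-- `f² ξ_i = -ξ_i + ξ_i = 0`, and skewness turns this into `|f ξ_i|² = 0`. -/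
theorem f_ξ (x : M) (i : Fin s) : S.f x (S.ξ i x) = 0 := by
  have h2 : S.f x (S.f x (S.ξ i x)) = 0 := by
    rw [S.f_sq, S.Q_ξ]
    simp [S.η_ξ]
  by_contra hne
  have h3 := S.f_skew x (S.ξ i x) (S.f x (S.ξ i x))
  rw [h2, map_zero, neg_zero] at h3
  exact (S.g.pos x _ hne).ne' h3

theorem inner_ξ (x : M) (i : Fin s) (v : TangentSpace (𝓡 (2 * n + s)) x) :
    S.g.inner x (S.ξ i x) v = S.η i x v := by
  have h := S.compatible x v (S.ξ i x)
  rw [f_ξ, map_zero, S.Q_ξ, S.g.symm] at h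
  simp only [S.η_ξ, mul_ite, mul_one, mul_zero, Finset.sum_ite_eq', Finset.mem_univ,
    if_true] at h
  linarith

/-- If `f v = 0`, the formula for `f²` reads `Qv = ∑ η^i(v) ξ_i = Q(∑ η^i(v) ξ_i)`, and `Q` is
injective. -/
theorem eq_of_f_eq_zero {x : M} {v : TangentSpace (𝓡 (2 * n + s)) x} (h : S.f x v = 0) :
    v = ∑ i, S.η i x v • S.ξ i x := by
  have h2 := S.f_sq x v
  rw [h, map_zero] at h2
  apply (S.Q_nonsingular x).1
  rw [map_sum]
  simp only [map_smul, S.Q_ξ]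
  rw [eq_comm, neg_add_eq_zero] at h2
  exact h2

/-- The fields `ξ_i` as bundled smooth fields. -/
def ξField (i : Fin s) : VField (𝓡 (2 * n + s)) M := ⟨S.ξ i, S.ξ_smooth i⟩

/-- The action of `f` on smooth fields. -/
def fField : VField (𝓡 (2 * n + s)) M →ₗ[Fn (𝓡 (2 * n + s)) M] VField (𝓡 (2 * n + s)) M where
  toFun X := ⟨fun x => S.f x (X x), by
    exact ContMDiff.clm_bundle_apply (F₁ := EuclideanSpace ℝ (Fin (2 * n + s)))
      (F₂ := EuclideanSpace ℝ (Fin (2 * n + s))) S.f_smooth X.contMDiff⟩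
  map_add' X Y := by ext x; exact map_add (S.f x) _ _
  map_smul' h X := by ext x; exact map_smul (S.f x) (h x) (X x)

theorem ξField_apply (i : Fin s) (x : M) : S.ξField i x = S.ξ i x := rfl

theorem sum_ξField_apply (x : M) : (∑ i, S.ξField i) x = S.ξbar x := VField.sum_apply _ _ _

theorem inn_ξField (i j : Fin s) : (connection S.g).inn (S.ξField i) (S.ξField j) =
    if i = j then 1 else 0 := by
  ext x
  rw [connection_inn]
  refine (S.ξ_orthonormal x i j).trans ?_
  split_ifs <;> rfl

theorem fField_ξField (i : Fin s) : S.fField (S.ξField i) = 0 := by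
  ext x
  exact S.f_ξ x i

theorem fField_skew (X Y : VField (𝓡 (2 * n + s)) M) :
    (connection S.g).inn (S.fField X) Y = - (connection S.g).inn X (S.fField Y) := by
  ext x
  exact S.f_skew x (X x) (Y x)

variable {S}

theorem IsWeakKenmotsu.nab_fField {β : ℝ} (hK : S.IsWeakKenmotsu (fun _ => β))
    (X Y : VField (𝓡 (2 * n + s)) M) :
    (connection S.g).nab X (S.fField Y) = S.fField ((connection S.g).nab X Y) +
      algebraMap ℝ (Fn (𝓡 (2 * n + s)) M) β •
        ((connection S.g).inn (S.fField X) Y • ∑ j, S.ξField j -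
          (connection S.g).inn (∑ j, S.ξField j) Y • S.fField X) := by
  ext x
  have h := hK.eq X Y X.contMDiff Y.contMDiff x
  rw [sub_eq_iff_eq_add'] at h
  have e : S.ηbar x (Y x) = (connection S.g).inn (∑ j, S.ξField j) Y x := by
    rw [connection_inn, sum_ξField_apply, ηbar, ξbar, map_sum, sum_apply]
    exact Finset.sum_congr rfl fun i _ => (S.inner_ξ x i _).symm
  rw [e, ← sum_ξField_apply] at h
  exact h

/-- Since `[f, f] = 0` here, normality says `∑ dη^i ⊗ ξ_i = 0`. Applying `η^i` gives `dη^i = 0`,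
which for a metric torsion-free connection is the symmetry of `∇ξ_i`. -/
theorem IsWeakKenmotsu.closed {β : ℝ} (hK : S.IsWeakKenmotsu (fun _ => β)) (hN : S.IsNormal)
    (i : Fin s) (X Y : VField (𝓡 (2 * n + s)) M) :
    (connection S.g).inn ((connection S.g).nab X (S.ξField i)) Y =
      (connection S.g).inn ((connection S.g).nab Y (S.ξField i)) X := by
  have hd (x : M) : dOneForm (S.η i) X Y x = 0 := by
    have h := hN X Y X.contMDiff Y.contMDiff x
    have h0 : nijenhuis S.f X Y x = 0 := by
      have h1 := congrArg (fun W : VField (𝓡 (2 * n + s)) M => W x)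
        ((connection S.g).nijenhuis_eq_zero S.fField S.fField_skew _ (∑ j, S.ξField j)
          (by simp [fField_ξField]) hK.nab_fField X Y)
      simp only [connection_br] at h1
      exact h1
    rw [h0, zero_add, smul_eq_zero_iff_right two_ne_zero] at h
    have h2 := congrArg (S.η i x) h
    simpa [S.η_ξ] using h2
  have key : (connection S.g).der X ((connection S.g).inn (S.ξField i) Y) -
      (connection S.g).der Y ((connection S.g).inn (S.ξField i) X) -
      (connection S.g).inn (S.ξField i) ((connection S.g).br X Y) = 0 := by
    ext x
    have h := hd x
    rw [dOneForm] at h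
    have e (Z : VField (𝓡 (2 * n + s)) M) : (fun p => S.η i p (Z p)) =
        ((connection S.g).inn (S.ξField i) Z) := by
      ext p
      exact (S.inner_ξ p i (Z p)).symm
    rw [e X, e Y, ← S.inner_ξ] at h
    rw [connection_br]
    have h' := (mul_eq_zero.1 h).resolve_left (by norm_num)
    exact h'
  rw [MetricConnection.br, (connection S.g).der_inn, (connection S.g).der_inn, map_sub] at key
  linear_combination key

theorem IsWeakKenmotsu.nab_ξField {β : ℝ} (hK : S.IsWeakKenmotsu (fun _ => β)) (hN : S.IsNormal)
    (X : VField (𝓡 (2 * n + s)) M) (i : Fin s) :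
    (connection S.g).nab X (S.ξField i) = algebraMap ℝ (Fn (𝓡 (2 * n + s)) M) β •
      (X - ∑ j, (connection S.g).inn (S.ξField j) X • S.ξField j) := by
  have span (i : Fin s) (X : VField (𝓡 (2 * n + s)) M) :
      (connection S.g).nab X (S.ξField i) - algebraMap ℝ (Fn (𝓡 (2 * n + s)) M) β • X =
      ∑ j, (connection S.g).inn (S.ξField j) ((connection S.g).nab X (S.ξField i) -
        algebraMap ℝ (Fn (𝓡 (2 * n + s)) M) β • X) • S.ξField j := by
    -- Here `f ξ_i = 0`, so the Kenmotsu equation becomes `f(∇_X ξ_i) = β fX`, and the kernel of `f`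
    -- is the span of the `ξ_j`.
    have h := hK.nab_fField X (S.ξField i)
    simp only [fField_ξField, map_zero, map_sum, LinearMap.sum_apply, inn_ξField] at h
    rw [S.fField_skew, fField_ξField] at h
    simp only [map_zero, neg_zero, zero_smul, zero_sub, Finset.sum_ite_eq', Finset.mem_univ,
      if_true, one_smul, smul_neg] at h
    have h2 : S.fField ((connection S.g).nab X (S.ξField i) -
        algebraMap ℝ (Fn (𝓡 (2 * n + s)) M) β • X) = 0 := by
      rw [map_sub, map_smul, sub_eq_add_neg]
      exact h.symm
    ext x
    have h3 := S.eq_of_f_eq_zero (congrArg (fun W : VField (𝓡 (2 * n + s)) M => W x) h2)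
    rw [VField.sum_apply]
    refine h3.trans (Finset.sum_congr rfl fun j _ => ?_)
    rw [VField.fsmul_apply, connection_inn, ξField_apply, S.inner_ξ]
  have h := span i X
  have h0 (j : Fin s) : (connection S.g).inn (S.ξField j) ((connection S.g).nab X (S.ξField i)) =
      0 := by
    rw [(connection S.g).inn_comm]
    exact (connection S.g).inn_nab_eq_zero S.ξField _ S.inn_ξField (hK.closed hN) span i j X
  simp only [map_sub, h0, zero_sub, map_smul, smul_eq_mul, neg_smul, Finset.sum_neg_distrib,
    mul_smul, ← Finset.smul_sum] at h
  rw [smul_sub]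
  linear_combination (norm := module) (1 : ℤ) • h

variable (S) in
/-- The algebra of vector fields of a normal weak `βf`-Kenmotsu manifold. -/
def kenmotsuAlgebra {β : ℝ} (hK : S.IsWeakKenmotsu (fun _ => β)) (hN : S.IsNormal) :
    KenmotsuAlgebra (Fn (𝓡 (2 * n + s)) M) (VField (𝓡 (2 * n + s)) M) (Fin s) where
  toMetricConnection := connection S.g
  f := S.fField
  ξ := S.ξField
  β := algebraMap ℝ _ β
  der_β X := X.der_algebraMap β
  inn_ξ_ξ := S.inn_ξField
  f_ξ := S.fField_ξField
  f_skew := S.fField_skew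
  nab_ξ := hK.nab_ξField hN
  nab_f := hK.nab_fField

end WeakMetricFStructure

end WeakMetric

end

/-! ### The Lie derivative of the `*`-Ricci tensor along the `ξ_i`. -/

noncomputable section

namespace WeakMetric

namespace KenmotsuAlgebra

variable {A 𝔛 ι : Type*} [CommRing A] [AddCommGroup 𝔛] [Module A 𝔛]
    [Fintype ι] [DecidableEq ι] (K : KenmotsuAlgebra A 𝔛 ι)

theorem br_ξ_P (i : ι) (X : 𝔛) : K.br (K.ξ i) (K.P X) = K.P (K.br (K.ξ i) X) := by
  simp [MetricConnection.br, nab_P, nab_ξ', P_P, P_ξ]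

theorem der_ξ_inn_P (i : ι) (X Y : 𝔛) : K.der (K.ξ i) (K.inn (K.P X) Y) =
    K.inn (K.P (K.br (K.ξ i) X)) Y + K.inn (K.P X) (K.br (K.ξ i) Y)
      + 2 * K.β * K.inn (K.P X) Y := by
  rw [der_ξ_inn, br_ξ_P, P_P]

/-- Together with `der_ξ_inn_P`: the Lie derivative along `ξ_i` multiplies both `g(f·,f·)` and
`g(P·,·)` by `2β`, so a proportionality between them can be differentiated without new tensor terms.
-/
theorem der_ξ_inn_f (i : ι) (X Y : 𝔛) : K.der (K.ξ i) (K.inn (K.f X) (K.f Y)) =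
    K.inn (K.f (K.br (K.ξ i) X)) (K.f Y) + K.inn (K.f X) (K.f (K.br (K.ξ i) Y))
      + 2 * K.β * K.inn (K.f X) (K.f Y) := by
  rw [der_ξ_inn, br_ξ_f, br_ξ_f, P_f]

/-- If `c g(fX, fY) = e g(PX, Y)` with `c` constant, then `e` is constant along `ξ_i`. -/
theorem der_ξ_mul_inn_P_eq_zero (i : ι) {c e : A} (hc : K.der (K.ξ i) c = 0)
    (h : ∀ X Y, c * K.inn (K.f X) (K.f Y) = e * K.inn (K.P X) Y) (X Y : 𝔛) :
    K.der (K.ξ i) e * K.inn (K.P X) Y = 0 := by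
  have h1 := congrArg (K.der (K.ξ i)) (h X Y)
  simp only [Derivation.leibniz, hc, der_ξ_inn_P, der_ξ_inn_f, smul_eq_mul] at h1
  linear_combination -h1 + h (K.br (K.ξ i) X) Y + h X (K.br (K.ξ i) Y) + 2 * K.β * h X Y

/-- The Lie derivative of the metric along `∑ δ^i ξ_i`. -/
theorem inn_nab_sum_smul_ξ (δ : ι → A) (X Y : 𝔛) :
    K.inn (K.nab X (∑ i, δ i • K.ξ i)) Y + K.inn X (K.nab Y (∑ i, δ i • K.ξ i)) =
      2 * ((∑ i, δ i) * K.β) * K.inn (K.P X) Y +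
        ∑ i, (K.der X (δ i) * K.inn (K.ξ i) Y + K.der Y (δ i) * K.inn (K.ξ i) X) := by
  have e (X Y : 𝔛) : K.inn (K.nab X (∑ i, δ i • K.ξ i)) Y =
      ((∑ i, δ i) * K.β) * K.inn (K.P X) Y + ∑ i, K.der X (δ i) * K.inn (K.ξ i) Y := by
    simp only [map_sum, K.nab_smul, nab_ξ', map_add, map_smul, LinearMap.sum_apply,
      LinearMap.add_apply, LinearMap.smul_apply, smul_eq_mul, Finset.sum_add_distrib,
      Finset.sum_mul, mul_assoc]
  rw [K.inn_comm X, e, e, Finset.sum_add_distrib, inn_P, inn_P, K.inn_comm Y, inn_P]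
  ring

end KenmotsuAlgebra

namespace WeakMetricFStructure

set_option linter.unusedSectionVars false

variable {n s : ℕ} {M : Type*} [TopologicalSpace M] [T2Space M]
  [ChartedSpace (EuclideanSpace ℝ (Fin (2 * n + s))) M]
  [IsManifold (𝓡 (2 * n + s)) ∞ M] (S : WeakMetricFStructure n s M)

/-- The orthogonal projection onto the distribution `D` at a point. -/
def proj (x : M) : TangentSpace (𝓡 (2 * n + s)) x →ₗ[ℝ] TangentSpace (𝓡 (2 * n + s)) x :=
  LinearMap.id - ∑ i, (S.η i x).toLinearMap.smulRight (S.ξ i x)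

theorem proj_apply (x : M) (v : TangentSpace (𝓡 (2 * n + s)) x) :
    S.proj x v = v - ∑ i, S.η i x v • S.ξ i x := by
  simp [proj]

theorem η_proj (x : M) (i : Fin s) (v : TangentSpace (𝓡 (2 * n + s)) x) :
    S.η i x (S.proj x v) = 0 := by
  simp [proj_apply, S.η_ξ]

theorem η_f (x : M) (i : Fin s) (v : TangentSpace (𝓡 (2 * n + s)) x) :
    S.η i x (S.f x v) = 0 := by
  have := S.f_skew x (S.ξ i x) v
  rw [S.f_ξ, map_zero, zero_apply, zero_eq_neg, S.inner_ξ] at this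
  exact this

theorem proj_f (x : M) (v : TangentSpace (𝓡 (2 * n + s)) x) : S.proj x (S.f x v) = S.f x v := by
  simp [proj_apply, η_f]

theorem f_proj (x : M) (v : TangentSpace (𝓡 (2 * n + s)) x) : S.f x (S.proj x v) = S.f x v := by
  simp [proj_apply, f_ξ]

theorem proj_ξ (x : M) (i : Fin s) : S.proj x (S.ξ i x) = 0 := by
  simp [proj_apply, S.η_ξ]

theorem inner_proj (x : M) (u v : TangentSpace (𝓡 (2 * n + s)) x) :
    S.g.inner x (S.proj x u) v = S.g.inner x u v - ∑ i, S.η i x u * S.η i x v := by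
  simp [proj_apply, inner_ξ]

theorem inner_ξbar (x : M) (v : TangentSpace (𝓡 (2 * n + s)) x) :
    S.g.inner x (S.ξbar x) v = S.ηbar x v := by
  simp [ξbar, ηbar, inner_ξ]

theorem f_ξbar (x : M) : S.f x (S.ξbar x) = 0 := by
  simp [ξbar, f_ξ]

theorem trace_proj (x : M) : LinearMap.trace ℝ _ (S.proj x) = 2 * n := by
  have h : LinearMap.trace ℝ (TangentSpace (𝓡 (2 * n + s)) x) LinearMap.id = 2 * n + s := by
    rw [LinearMap.trace_id]
    have : Module.finrank ℝ (TangentSpace (𝓡 (2 * n + s)) x) = 2 * n + s :=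
      (finrank_euclideanSpace_fin (𝕜 := ℝ) (n := 2 * n + s))
    rw [this]
    push_cast
    ring
  rw [proj, map_sub, h, map_sum]
  simp [LinearMap.trace_smulRight, S.η_ξ]

/-- The contact distribution is nonzero. -/
theorem exists_inner_proj_pos (hn : 0 < n) (x : M) :
    ∃ u, 0 < S.g.inner x (S.proj x (S.f x u)) (S.f x u) := by
  by_contra! h
  have hf : (S.f x).toLinearMap = 0 := by
    ext v
    by_contra hv
    have h1 := h v
    rw [proj_f] at h1
    exact absurd (S.g.pos x _ hv) (not_lt.2 h1)
  have := S.f_rank x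
  rw [hf, LinearMap.range_zero, finrank_bot] at this
  omega

/-- The endomorphism `z ↦ f R_{u, fv} z`. -/
def starCurvature (x : M) (u v : TangentSpace (𝓡 (2 * n + s)) x) :
    TangentSpace (𝓡 (2 * n + s)) x →ₗ[ℝ] TangentSpace (𝓡 (2 * n + s)) x :=
  (S.f x).toLinearMap ∘ₗ curvatureTensor S.g x u (S.f x v)

theorem starCurvature_apply (x : M) (u v z : TangentSpace (𝓡 (2 * n + s)) x) :
    S.starCurvature x u v z = S.f x (curvatureTensor S.g x u (S.f x v) z) := rfl

theorem starRicci_eq_trace (x : M) (u v : TangentSpace (𝓡 (2 * n + s)) x) :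
    S.starRicci x u v = (1 / 2) * LinearMap.trace ℝ _ (S.starCurvature x u v) := by
  rw [← traceAt_linear]
  rfl

theorem starRicci_proj_right (x : M) (u v : TangentSpace (𝓡 (2 * n + s)) x) :
    S.starRicci x u (S.proj x v) = S.starRicci x u v := by
  simp only [starRicci, f_proj]

section Kenmotsu

variable {S} {β : ℝ} (hK : S.IsWeakKenmotsu (fun _ => β)) (hN : S.IsNormal)

theorem kenmotsuAlgebra_P_apply (X : VField (𝓡 (2 * n + s)) M) (x : M) :
    (S.kenmotsuAlgebra hK hN).P X x = S.proj x (X x) := by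
  rw [KenmotsuAlgebra.P_apply, proj_apply, VField.sub_apply, VField.sum_apply]
  congr 1
  refine Finset.sum_congr rfl fun i _ => ?_
  rw [← S.inner_ξ]
  rfl

theorem kenmotsuAlgebra_ξb_apply (x : M) : (S.kenmotsuAlgebra hK hN).ξb x = S.ξbar x :=
  VField.sum_apply _ _ _

theorem kenmotsuAlgebra_inn_apply (X Y : VField (𝓡 (2 * n + s)) M) (x : M) :
    (S.kenmotsuAlgebra hK hN).inn X Y x = S.g.inner x (X x) (Y x) := rfl

theorem kenmotsuAlgebra_f_apply (X : VField (𝓡 (2 * n + s)) M) (x : M) :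
    (S.kenmotsuAlgebra hK hN).f X x = S.f x (X x) := rfl

theorem kenmotsuAlgebra_ξ_apply (i : Fin s) (x : M) :
    (S.kenmotsuAlgebra hK hN).ξ i x = S.ξ i x := rfl

theorem kenmotsuAlgebra_β_apply (x : M) : (S.kenmotsuAlgebra hK hN).β x = β := rfl

theorem kenmotsuAlgebra_R_apply (X Y Z : VField (𝓡 (2 * n + s)) M) (x : M) :
    (S.kenmotsuAlgebra hK hN).R X Y Z x = curvatureTensor S.g x (X x) (Y x) (Z x) :=
  (curvatureAt_apply S.g X Y Z x).symm

theorem natCast_apply (k : ℕ) (x : M) : (k : Fn (𝓡 (2 * n + s)) M) x = k :=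
  map_natCast (ContMDiffMap.evalRingHom (I := (𝓡 (2 * n + s))) (I' := 𝓘(ℝ)) (n := ∞) x) k

theorem curvatureTensor_ξ_left (hK : S.IsWeakKenmotsu (fun _ => β)) (hN : S.IsNormal)
    (x : M) (i : Fin s) (u v : TangentSpace (𝓡 (2 * n + s)) x) :
    curvatureTensor S.g x (S.ξ i x) u v = β ^ 2 •
      (S.ηbar x v • S.proj x u - S.g.inner x (S.proj x u) v • S.ξbar x) := by
  rw [pow_two]
  have h := congrArg (fun W : VField (𝓡 (2 * n + s)) M => W x)
    ((S.kenmotsuAlgebra hK hN).R_ξ_left i (VField.through x u) (VField.through x v))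
  simpa only [kenmotsuAlgebra_R_apply, VField.fsmul_apply, VField.sub_apply,
    ContMDiffMap.coe_mul, Pi.mul_apply, kenmotsuAlgebra_P_apply, kenmotsuAlgebra_ξb_apply,
    inner_ξbar, kenmotsuAlgebra_inn_apply, kenmotsuAlgebra_ξ_apply,
    kenmotsuAlgebra_β_apply, VField.through_apply] using h

theorem curvatureTensor_f (hK : S.IsWeakKenmotsu (fun _ => β)) (hN : S.IsNormal)
    (x : M) (u v w : TangentSpace (𝓡 (2 * n + s)) x) :
    curvatureTensor S.g x u v (S.f x w) = S.f x (curvatureTensor S.g x u v w) + β ^ 2 •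
    ((S.ηbar x u * S.g.inner x (S.f x v) w - S.ηbar x v * S.g.inner x (S.f x u) w) • S.ξbar x
    + (s * S.g.inner x (S.f x v) w) • S.proj x u
    - (s * S.g.inner x (S.f x u) w) • S.proj x v
    - (s * S.g.inner x (S.proj x u) w) • S.f x v
    + (s * S.g.inner x (S.proj x v) w) • S.f x u
    + S.ηbar x w • (S.ηbar x v • S.f x u - S.ηbar x u • S.f x v)) := by
  rw [pow_two]
  have h := congrArg (fun W : VField (𝓡 (2 * n + s)) M => W x)
    ((S.kenmotsuAlgebra hK hN).R_f (VField.through x u) (VField.through x v) (VField.through x w))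
  simpa only [kenmotsuAlgebra_R_apply, VField.fsmul_apply, VField.sub_apply, VField.add_apply,
    ContMDiffMap.coe_mul, Pi.mul_apply, ContMDiffMap.coe_sub, Pi.sub_apply,
    kenmotsuAlgebra_P_apply, kenmotsuAlgebra_ξb_apply, kenmotsuAlgebra_f_apply,
    inner_ξbar, kenmotsuAlgebra_inn_apply, kenmotsuAlgebra_ξ_apply,
    kenmotsuAlgebra_β_apply, VField.through_apply, Fintype.card_fin, natCast_apply]
    using h

variable (S) in
theorem trace_f (x : M) : LinearMap.trace ℝ _ (S.f x).toLinearMap = 0 := by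
  have h := trace_eq_of_adjoint S.g (x := x) (a := (S.f x).toLinearMap)
    (a' := -(S.f x).toLinearMap) (fun u v => by simpa using S.f_skew x u v)
  rw [map_neg] at h
  linarith

theorem trace_rank_one (x : M) (φ : TangentSpace (𝓡 (2 * n + s)) x →ₗ[ℝ] ℝ)
    (v : TangentSpace (𝓡 (2 * n + s)) x) : LinearMap.trace ℝ _ (φ.smulRight v) = φ v :=
  LinearMap.trace_smulRight φ v

/-- In `f R_{ξ_i,fv} z` the `ξ̄` component is killed by `f`. What remains is the rank-one map `z ↦
β² η̄(z) f²v`, of trace `β² η̄(f²v) = 0`. -/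
theorem starRicci_ξ_left (hK : S.IsWeakKenmotsu (fun _ => β)) (hN : S.IsNormal)
    (x : M) (i : Fin s) (v : TangentSpace (𝓡 (2 * n + s)) x) :
    S.starRicci x (S.ξ i x) v = 0 := by
  rw [starRicci_eq_trace]
  have : S.starCurvature x (S.ξ i x) v = β ^ 2 •
      (S.g.inner x (S.ξbar x)).toLinearMap.smulRight (S.f x (S.f x v)) := by
    ext z
    simp [starCurvature_apply, curvatureTensor_ξ_left hK hN, f_ξbar, proj_f, inner_ξbar]
  rw [this, map_smul, trace_rank_one]
  simp [inner_ξbar, ηbar, η_f]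

theorem starRicci_proj_left (hK : S.IsWeakKenmotsu (fun _ => β)) (hN : S.IsNormal)
    (x : M) (u v : TangentSpace (𝓡 (2 * n + s)) x) :
    S.starRicci x (S.proj x u) v = S.starRicci x u v := by
  have hL : ∃ L : TangentSpace (𝓡 (2 * n + s)) x →ₗ[ℝ] ℝ, ∀ u, S.starRicci x u v = L u :=
    ⟨{  toFun u := S.starRicci x u v
        map_add' u u' := by
          simp only [starRicci_eq_trace, starCurvature, map_add, LinearMap.add_apply,
            LinearMap.comp_add, mul_add]
        map_smul' c u := by
          simp only [starRicci_eq_trace, starCurvature, map_smul, LinearMap.smul_apply,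
            LinearMap.comp_smul, smul_eq_mul, RingHom.id_apply]
          ring }, fun _ => rfl⟩
  obtain ⟨L, hL⟩ := hL
  rw [hL, hL, proj_apply, map_sub, map_sum, sub_eq_self]
  refine Finset.sum_eq_zero fun i _ => ?_
  rw [map_smul, ← hL, starRicci_ξ_left hK hN, smul_zero]

/-- The Lie derivative of the `*`-Ricci tensor along `ξ_i`. -/
theorem mvfderiv_starRicci (hK : S.IsWeakKenmotsu (fun _ => β)) (hN : S.IsNormal)
    (i : Fin s) (X Y : VField (𝓡 (2 * n + s)) M) (x : M) :
    mvfderiv (𝓡 (2 * n + s)) (fun p => S.starRicci p (X p) (Y p)) x (S.ξ i x) =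
      S.starRicci x ((S.ξField i).bracket X x) (Y x) +
      S.starRicci x (X x) ((S.ξField i).bracket Y x) -
      2 * s * β ^ 3 * S.g.inner x (S.f x (X x)) (S.f x (Y x)) := by
  set K := S.kenmotsuAlgebra hK hN with hKdef
  have hbr (Z : VField (𝓡 (2 * n + s)) M) : K.br (K.ξ i) Z = (S.ξField i).bracket Z :=
    connection_br S.g (S.ξField i) Z
  -- `T` is the Lie derivative of `z ↦ f R_{X,fY} z`: `f` commutes with the bracket by `ξ_i`, and
  -- applying `f` to the correction in `br_ξ_R` removes its `ξ̄` part and leaves two rank-one maps.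
  set T := S.starCurvature x ((S.ξField i).bracket X x) (Y x) +
    S.starCurvature x (X x) ((S.ξField i).bracket Y x) -
    (2 * s * β ^ 3) • ((S.g.inner x (S.f x (Y x))).toLinearMap.smulRight (S.f x (X x)) -
      (S.g.inner x (S.proj x (X x))).toLinearMap.smulRight (S.f x (S.f x (Y x)))) with hTdef
  have hT := mvfderiv_trace S.g (S.ξField i) (fun Z => K.f (K.R X (K.f Y) Z))
    (fun p => S.starCurvature p (X p) (Y p))
    (fun Z p => by
      rw [kenmotsuAlgebra_f_apply, kenmotsuAlgebra_R_apply]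
      rfl) x T (fun Z => by
        have h1 : (S.ξField i).bracket (K.f (K.R X (K.f Y) Z)) =
            K.f (K.br (K.ξ i) (K.R X (K.f Y) Z)) := by
          rw [← hbr, K.br_ξ_f]
        rw [h1, K.br_ξ_R, K.br_ξ_f, hbr, hbr, hbr, K.inn_ξb_f, K.P_f]
        have e2 : (2 : Fn (𝓡 (2 * n + s)) M) x = 2 := by exact_mod_cast natCast_apply 2 x
        simp only [kenmotsuAlgebra_f_apply, hKdef, VField.add_apply, VField.sub_apply,
          VField.fsmul_apply, kenmotsuAlgebra_R_apply, kenmotsuAlgebra_P_apply,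
          kenmotsuAlgebra_ξb_apply, ContMDiffMap.coe_mul, Pi.mul_apply, ContMDiffMap.coe_sub,
          Pi.sub_apply, kenmotsuAlgebra_inn_apply, map_add, map_sub,
          map_smul, f_ξbar, f_proj, Fintype.card_fin, natCast_apply, e2, kenmotsuAlgebra_β_apply,
          hTdef, LinearMap.sub_apply, LinearMap.add_apply, LinearMap.smul_apply,
          LinearMap.smulRight_apply, starCurvature_apply]
        simp only [ContinuousLinearMap.coe_coe]
        module)
  have h2 : (fun p => S.starRicci p (X p) (Y p)) = (fun p => (1 / 2 : ℝ)) *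
      (fun p => LinearMap.trace ℝ _ (S.starCurvature p (X p) (Y p))) := by
    ext p
    exact starRicci_eq_trace S p _ _
  have hd := mdiffAt_trace S.g (fun Z => K.f (K.R X (K.f Y) Z))
    (fun p => S.starCurvature p (X p) (Y p))
    (fun Z p => by
      rw [kenmotsuAlgebra_f_apply, kenmotsuAlgebra_R_apply]
      rfl) x
  rw [h2, mvfderiv_mul mdifferentiableAt_const hd, mvfderiv_const]
  have h3 : mvfderiv (𝓡 (2 * n + s)) (fun p => LinearMap.trace ℝ _ (S.starCurvature p (X p) (Y p)))
      x (S.ξ i x) = LinearMap.trace ℝ _ T := hT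
  simp only [smul_zero, add_zero, smul_apply, h3, hTdef, map_sub, map_add, map_smul,
    trace_rank_one, starRicci_eq_trace, smul_eq_mul]
  have h4 := S.f_skew x (S.proj x (X x)) (S.f x (Y x))
  rw [f_proj] at h4
  simp only [ContinuousLinearMap.coe_coe, S.g.symm x (S.f x (Y x)) (S.f x (X x))]
  -- By skewness of `f` each of the two rank-one terms contributes `g(fX, fY)`; the resulting factor
  -- `2` cancels the `1/2` in the definition of `Ric*`.
  linear_combination (s * β ^ 3) * h4

end Kenmotsu

end WeakMetricFStructure

end WeakMetric

end

/-! ### Recovering the Ricci tensor from the `*`-Ricci tensor. -/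

noncomputable section

namespace WeakMetric

namespace WeakMetricFStructure

set_option linter.unusedSectionVars false

variable {n s : ℕ} {M : Type*} [TopologicalSpace M] [T2Space M]
  [ChartedSpace (EuclideanSpace ℝ (Fin (2 * n + s))) M]
  [IsManifold (𝓡 (2 * n + s)) ∞ M] (S : WeakMetricFStructure n s M)

/-- The endomorphism `w ↦ R_{w,u} v`, whose trace is `Ric(u, v)`. -/
def ricciEnd (x : M) (u v : TangentSpace (𝓡 (2 * n + s)) x) :
    TangentSpace (𝓡 (2 * n + s)) x →ₗ[ℝ] TangentSpace (𝓡 (2 * n + s)) x :=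
  ((curvatureTensor S.g x).flip u).flip v

theorem ricciEnd_apply (x : M) (u v w : TangentSpace (𝓡 (2 * n + s)) x) :
    S.ricciEnd x u v w = curvatureTensor S.g x w u v := rfl

/-- Bianchi splits `f R_{u,fv} w` into `f R_{w,fv} u - f R_{w,u} fv`. The two pieces have opposite
traces, so the `1/2` disappears. -/
theorem starRicci_eq_neg_trace (x : M) (u v : TangentSpace (𝓡 (2 * n + s)) x) :
    S.starRicci x u v =
      - LinearMap.trace ℝ _ ((S.f x).toLinearMap ∘ₗ S.ricciEnd x u (S.f x v)) := by
  set F₁ := (S.f x).toLinearMap ∘ₗ S.ricciEnd x (S.f x v) u with hF₁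
  set N := S.ricciEnd x u (S.f x v) with hN
  have h1 : S.starCurvature x u v = F₁ - (S.f x).toLinearMap ∘ₗ N := by
    ext w
    have h := curvatureAt_bianchi S.g x u (S.f x v) w
    rw [curvatureAt_swap S.g x (S.f x v)] at h
    have h' : curvatureAt S.g x u (S.f x v) w =
        curvatureAt S.g x w (S.f x v) u - curvatureAt S.g x w u (S.f x v) := by
      linear_combination (norm := module) (1 : ℤ) • h
    simp only [starCurvature_apply, hF₁, hN, LinearMap.sub_apply, LinearMap.comp_apply,
      ricciEnd_apply, curvatureTensor_apply, h', map_sub, ContinuousLinearMap.coe_coe]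
  -- The curvature symmetries make `-N ∘ f` the adjoint of `F₁`, and the trace is cyclic.
  have h2 : LinearMap.trace ℝ _ F₁ = LinearMap.trace ℝ _ (-(N ∘ₗ (S.f x).toLinearMap)) := by
    refine trace_eq_of_adjoint S.g fun w z => ?_
    simp only [hF₁, hN, LinearMap.comp_apply, ricciEnd_apply, curvatureTensor_apply,
      LinearMap.neg_apply, ContinuousLinearMap.coe_coe, map_neg]
    rw [S.f_skew, inner_curvatureAt_pair, inner_curvatureAt_skew, curvatureAt_swap, map_neg,
      neg_apply, S.g.symm x w]
    ring
  rw [starRicci_eq_trace, h1, map_sub, h2, map_neg, LinearMap.trace_comp_comm']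
  ring

variable {S} {β : ℝ}

/-- The Ricci tensor when `f² = -q P` and `Ric* = -s β² g(f ·, f ·)` at a point. -/
theorem ricci_eq_of_starRicci (hK : S.IsWeakKenmotsu (fun _ => β)) (hN : S.IsNormal) {x : M}
    {q : ℝ} (hq : q ≠ 0) (hff : ∀ u, S.f x (S.f x u) = -q • S.proj x u)
    (hstar : ∀ u v, S.starRicci x u v = -(s * β ^ 2) * S.g.inner x (S.f x u) (S.f x v))
    (u v : TangentSpace (𝓡 (2 * n + s)) x) :
    ricci S.g x u v = -2 * s * n * β ^ 2 * S.g.inner x (S.proj x u) v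
      - 2 * n * β ^ 2 * (S.ηbar x u * S.ηbar x v) := by
  have hsymm (w z : TangentSpace (𝓡 (2 * n + s)) x) :
      S.g.inner x (S.proj x w) z = S.g.inner x (S.proj x z) w := by
    simp only [inner_proj, S.g.symm x w z, mul_comm]
  have hfuv : S.g.inner x (S.f x u) (S.f x v) = q * S.g.inner x (S.proj x u) v := by
    have := S.f_skew x (S.f x u) v
    rw [hff, map_smul, smul_apply, smul_eq_mul] at this
    linarith
  -- `curvatureTensor_f` moves the inner `f` outside, where it meets the outer one as `f² = -qP`;
  -- the sum over `j` is the part of `R_{w,u} v` removed by `P`.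
  have h1 : (S.f x).toLinearMap ∘ₗ S.ricciEnd x u (S.f x v) =
      (-q) • (S.ricciEnd x u v -
        ∑ j, ((S.η j x).toLinearMap ∘ₗ S.ricciEnd x u v).smulRight (S.ξ j x)) +
      β ^ 2 • ((s * S.g.inner x (S.f x u) v) • (S.f x).toLinearMap
        + (s : ℝ) • (S.g.inner x (S.f x v)).toLinearMap.smulRight (S.f x u)
        + (s * q) • (S.g.inner x (S.proj x v)).toLinearMap.smulRight (S.proj x u)
        - (s * q * S.g.inner x (S.proj x u) v + q * (S.ηbar x u * S.ηbar x v)) • S.proj x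
        + (q * S.ηbar x v) • (S.g.inner x (S.ξbar x)).toLinearMap.smulRight (S.proj x u)) := by
    ext w
    have hskew : S.g.inner x (S.f x w) v = - S.g.inner x (S.f x v) w := by
      rw [S.f_skew, S.g.symm]
    simp only [LinearMap.comp_apply, LinearMap.add_apply, LinearMap.sub_apply,
      LinearMap.smul_apply, LinearMap.sum_apply, LinearMap.smulRight_apply, ricciEnd_apply,
      ContinuousLinearMap.coe_coe, curvatureTensor_f hK hN, map_add, map_sub, map_smul, f_ξbar,
      f_proj, hff, inner_ξbar, hskew, hsymm w v, S.proj_apply x (curvatureTensor S.g x w u v)]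
    module
  -- A rank-one trace is an evaluation at `ξ_j`, so only `η^j(R_{ξ_j,u} v)` is needed.
  have h2 (j : Fin s) : LinearMap.trace ℝ _
      (((S.η j x).toLinearMap ∘ₗ S.ricciEnd x u v).smulRight (S.ξ j x)) =
      - (β ^ 2 * S.g.inner x (S.proj x u) v) := by
    rw [trace_rank_one]
    simp only [LinearMap.comp_apply, ricciEnd_apply, curvatureTensor_ξ_left hK hN,
      ContinuousLinearMap.coe_coe, map_smul, map_sub, η_proj, ξbar, map_sum, S.η_ξ]
    simp
  have h3 : LinearMap.trace ℝ _ (S.ricciEnd x u v) = ricci S.g x u v :=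
    (traceAt_linear x (S.ricciEnd x u v)).symm
  have h4 : S.g.inner x (S.ξbar x) (S.proj x u) = 0 := by
    simp [inner_ξbar, ηbar, η_proj]
  have h5 : S.g.inner x (S.proj x v) (S.proj x u) = S.g.inner x (S.proj x u) v := by
    rw [inner_proj, S.g.symm x v]
    simp [η_proj]
  have h6 := S.starRicci_eq_neg_trace x u v
  rw [hstar, hfuv, h1] at h6
  simp only [map_add, map_sub, map_smul, map_sum, h2, h3, trace_f, trace_proj, trace_rank_one,
    ContinuousLinearMap.coe_coe, h4, h5, S.g.symm x (S.f x v), hfuv, Finset.sum_const,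
    Finset.card_univ, Fintype.card_fin, smul_eq_mul, nsmul_eq_mul] at h6
  refine mul_left_cancel₀ hq ?_
  linear_combination -h6

end WeakMetricFStructure

end WeakMetric

end

/-! ### Scalar curvature and the soliton equation. -/

noncomputable section

namespace WeakMetric

section MetricTrace

set_option linter.unusedSectionVars false

variable {E : Type*} [NormedAddCommGroup E] [NormedSpace ℝ E] [FiniteDimensional ℝ E]
  {H : Type*} [TopologicalSpace H] {I : ModelWithCorners ℝ E H}
  {M : Type*} [TopologicalSpace M] [ChartedSpace H M] [IsManifold I ∞ M]
  (g : ContMDiffRiemannianMetric I ∞ E (fun x : M => TangentSpace I x))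

theorem metricTrace_inner_left (x : M) (A : TangentSpace I x →ₗ[ℝ] TangentSpace I x) :
    metricTrace g x (fun u v => g.inner x (A u) v) = LinearMap.trace ℝ _ A := by
  rw [← traceAt_linear]
  refine Finset.sum_congr rfl fun i _ => ?_
  exact (g.symm x _ _).trans (inner_sharp g x _ _)

end MetricTrace

namespace WeakMetricFStructure

set_option linter.unusedSectionVars false

variable {n s : ℕ} {M : Type*} [TopologicalSpace M] [T2Space M]
  [ChartedSpace (EuclideanSpace ℝ (Fin (2 * n + s))) M]
  [IsManifold (𝓡 (2 * n + s)) ∞ M] {S : WeakMetricFStructure n s M}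

/-- The scalar curvature of an `η`-Einstein metric. -/
theorem IsEtaEinstein.scalarCurvature_eq {a b : M → ℝ} (h : S.IsEtaEinstein a b) (x : M) :
    scalarCurvature S.g x = 2 * n * a x + s * (a x + b x) := by
  have e : ricci S.g x = fun u v => S.g.inner x ((a x • S.proj x + (a x + b x) •
      (S.g.inner x (S.ξbar x)).toLinearMap.smulRight (S.ξbar x)) u) v := by
    ext u v
    rw [h.eq]
    simp only [LinearMap.add_apply, LinearMap.smul_apply, LinearMap.smulRight_apply,
      ContinuousLinearMap.coe_coe, map_add, map_smul, add_apply, smul_apply, inner_proj,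
      inner_ξbar, smul_eq_mul]
    ring
  rw [scalarCurvature, e, metricTrace_inner_left, map_add, map_smul, map_smul, trace_proj,
    trace_rank_one]
  have hs : S.ηbar x (S.ξbar x) = s := by
    simp [ηbar, ξbar, S.η_ξ]
  simp only [ContinuousLinearMap.coe_coe, inner_ξbar, hs, smul_eq_mul]
  ring

section Soliton

variable {β lam mu : ℝ} {δ : Fin s → Fn (𝓡 (2 * n + s)) M}

theorem lieDerivMetric_sum_smul_ξ (hK : S.IsWeakKenmotsu (fun _ => β)) (hN : S.IsNormal)
    (δ : Fin s → Fn (𝓡 (2 * n + s)) M) (X Y : VField (𝓡 (2 * n + s)) M) (x : M) :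
    lieDerivMetric S.g (fun p => ∑ i, δ i p • S.ξ i p) X Y x =
      2 * ((∑ i, δ i x) * β) * S.g.inner x (S.proj x (X x)) (Y x) +
        ∑ i, (mvfderiv (𝓡 (2 * n + s)) (δ i) x (X x) * S.η i x (Y x) +
          mvfderiv (𝓡 (2 * n + s)) (δ i) x (Y x) * S.η i x (X x)) := by
  set K := S.kenmotsuAlgebra hK hN with hKdef
  set V : VField (𝓡 (2 * n + s)) M := ∑ i, δ i • K.ξ i with hV
  have hVx : (fun p => ∑ i, δ i p • S.ξ i p) = V := by
    ext p
    rw [hV, VField.sum_apply]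
    rfl
  have h1 : lieDerivMetric S.g V X Y x = (K.der V (K.inn X Y) - K.inn (K.br V X) Y -
      K.inn X (K.br V Y)) x := by
    have hbr (Z : VField (𝓡 (2 * n + s)) M) : K.br V Z = V.bracket Z := connection_br S.g V Z
    rw [hbr, hbr]
    rfl
  have h2 : K.der V (K.inn X Y) - K.inn (K.br V X) Y - K.inn X (K.br V Y) =
      K.inn (K.nab X V) Y + K.inn X (K.nab Y V) := by
    rw [K.der_inn, MetricConnection.br, MetricConnection.br]
    simp only [map_sub, LinearMap.sub_apply]
    ring
  have e2 : (2 : Fn (𝓡 (2 * n + s)) M) x = 2 := by exact_mod_cast natCast_apply 2 x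
  rw [hVx, h1, h2, hV, K.inn_nab_sum_smul_ξ]
  simp only [ContMDiffMap.coe_add, Pi.add_apply, ContMDiffMap.coe_mul, Pi.mul_apply, e2,
    Fn.sum_apply, hKdef, kenmotsuAlgebra_β_apply, kenmotsuAlgebra_inn_apply,
    kenmotsuAlgebra_P_apply, kenmotsuAlgebra_ξ_apply, inner_ξ]
  rfl

/-- The soliton equation for a potential field tangent to the span of the `ξ_i`, pointwise. -/
theorem IsStarEtaRicciSoliton.pointwise (hK : S.IsWeakKenmotsu (fun _ => β)) (hN : S.IsNormal)
    (hsol : S.IsStarEtaRicciSoliton (fun p => ∑ i, δ i p • S.ξ i p) lam mu)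
    (x : M) (u v : TangentSpace (𝓡 (2 * n + s)) x) :
    (∑ i, δ i x) * β * S.g.inner x (S.proj x u) v +
      (1 / 2) * ∑ i, (mvfderiv (𝓡 (2 * n + s)) (δ i) x u * S.η i x v +
        mvfderiv (𝓡 (2 * n + s)) (δ i) x v * S.η i x u) + S.starRicci x u v =
      lam * S.g.inner x (S.proj x u) v + (lam + mu) * (S.ηbar x u * S.ηbar x v) := by
  have h := hsol (VField.through x u) (VField.through x v) (VField.through x u).contMDiff
    (VField.through x v).contMDiff x
  rw [lieDerivMetric_sum_smul_ξ hK hN] at h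
  simp only [VField.through_apply] at h
  rw [← inner_proj] at h
  linarith

/-- The soliton equation on the pair `(u, ξ_i)`: `Ric*` vanishes there because `f ξ_i = 0`, the
right side vanishes because `u ∈ D`, and only half of `u(δ^i)` survives. -/
theorem IsStarEtaRicciSoliton.mvfderiv_eq_zero (hK : S.IsWeakKenmotsu (fun _ => β))
    (hN : S.IsNormal) (hsol : S.IsStarEtaRicciSoliton (fun p => ∑ i, δ i p • S.ξ i p) lam mu)
    (i : Fin s) {x : M} {u : TangentSpace (𝓡 (2 * n + s)) x} (hu : S.InD x u) :
    mvfderiv (𝓡 (2 * n + s)) (δ i) x u = 0 := by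
  have h := hsol.pointwise hK hN x u (S.ξ i x)
  rw [← starRicci_proj_right, proj_ξ, inner_proj] at h
  simp only [hu _, ηbar, S.η_ξ, S.g.symm x u, inner_ξ] at h
  simpa [starRicci_eq_trace, starCurvature] using h

theorem IsStarEtaRicciSoliton.mvfderiv_ξ (hK : S.IsWeakKenmotsu (fun _ => β))
    (hN : S.IsNormal) (hsol : S.IsStarEtaRicciSoliton (fun p => ∑ i, δ i p • S.ξ i p) lam mu)
    (i j : Fin s) (x : M) :
    mvfderiv (𝓡 (2 * n + s)) (δ i) x (S.ξ j x) + mvfderiv (𝓡 (2 * n + s)) (δ j) x (S.ξ i x) =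
      2 * (lam + mu) := by
  have h := hsol.pointwise hK hN x (S.ξ j x) (S.ξ i x)
  rw [starRicci_ξ_left hK hN, proj_ξ] at h
  simp only [ηbar, S.η_ξ, map_zero, zero_apply, mul_ite, mul_one, mul_zero,
    Finset.sum_add_distrib, Finset.sum_ite_eq', Finset.mem_univ, if_true] at h
  linarith

/-- The `*`-Ricci tensor is a multiple of the metric of the contact distribution. -/
theorem IsStarEtaRicciSoliton.starRicci_eq (hK : S.IsWeakKenmotsu (fun _ => β)) (hN : S.IsNormal)
    (hsol : S.IsStarEtaRicciSoliton (fun p => ∑ i, δ i p • S.ξ i p) lam mu)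
    (x : M) (u v : TangentSpace (𝓡 (2 * n + s)) x) :
    S.starRicci x u v = (lam - β * ∑ i, δ i x) * S.g.inner x (S.proj x u) v := by
  have h := hsol.pointwise hK hN x (S.proj x u) (S.proj x v)
  rw [starRicci_proj_right, starRicci_proj_left hK hN] at h
  have h5 : S.g.inner x (S.proj x (S.proj x u)) (S.proj x v) = S.g.inner x (S.proj x u) v := by
    have : S.proj x (S.proj x u) = S.proj x u := by
      rw [S.proj_apply x (S.proj x u)]
      simp [η_proj]
    rw [this, S.g.symm, inner_proj, S.g.symm]
    simp [η_proj]
  simp only [η_proj, ηbar, h5] at h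
  simp only [mul_zero, add_zero, Finset.sum_const_zero] at h
  linarith

/-- `φ = λ - β ∑ δ^i`, the factor of proportionality between `Ric*` and the metric of the contact
distribution. -/
def starFactor (β lam : ℝ) (δ : Fin s → Fn (𝓡 (2 * n + s)) M) : Fn (𝓡 (2 * n + s)) M :=
  algebraMap ℝ _ lam + algebraMap ℝ _ (-β) * ∑ i, δ i

theorem starFactor_apply (x : M) : starFactor β lam δ x = lam - β * ∑ i, δ i x := by
  have h : starFactor β lam δ x = lam + -β * (∑ i, δ i) x := rfl
  rw [h, Fn.sum_apply]
  ring

/-- The Lie derivative along `ξ_i` of both sides of `Ric* = φ g(P·,·)`; the terms with brackets of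
`X` and `Y` cancel. -/
theorem IsStarEtaRicciSoliton.inner_f_f_mul (hK : S.IsWeakKenmotsu (fun _ => β))
    (hN : S.IsNormal)
    (hsol : S.IsStarEtaRicciSoliton (fun p => ∑ i, δ i p • S.ξ i p) lam mu)
    (i : Fin s) (X Y : VField (𝓡 (2 * n + s)) M) (x : M) :
    2 * s * β ^ 3 * S.g.inner x (S.f x (X x)) (S.f x (Y x)) =
      -(mvfderiv (𝓡 (2 * n + s)) (starFactor β lam δ) x (S.ξ i x) +
        2 * β * starFactor β lam δ x) * S.g.inner x (S.proj x (X x)) (Y x) := by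
  set φ := starFactor β lam δ with hφ
  set Ψ := (S.kenmotsuAlgebra hK hN).inn ((S.kenmotsuAlgebra hK hN).P X) Y with hΨ
  have hΨx (p : M) : Ψ p = S.g.inner p (S.proj p (X p)) (Y p) := by
    rw [hΨ, kenmotsuAlgebra_inn_apply, kenmotsuAlgebra_P_apply]
  have h1 := mvfderiv_starRicci hK hN i X Y x
  have h2 : (fun p => S.starRicci p (X p) (Y p)) = (fun p => φ p) * (fun p => Ψ p) := by
    ext p
    rw [hsol.starRicci_eq hK hN, ← starFactor_apply, Pi.mul_apply, hΨx]
  have h3 : mvfderiv (𝓡 (2 * n + s)) (fun p => Ψ p) x (S.ξ i x) =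
      S.g.inner x (S.proj x ((S.ξField i).bracket X x)) (Y x) +
      S.g.inner x (S.proj x (X x)) ((S.ξField i).bracket Y x) + 2 * β * Ψ x := by
    have h := congrArg (fun h : Fn (𝓡 (2 * n + s)) M => h x)
      ((S.kenmotsuAlgebra hK hN).der_ξ_inn_P i X Y)
    have hbr (Z : VField (𝓡 (2 * n + s)) M) : (S.kenmotsuAlgebra hK hN).br
        ((S.kenmotsuAlgebra hK hN).ξ i) Z = (S.ξField i).bracket Z :=
      connection_br S.g (S.ξField i) Z
    have e2 : (2 : Fn (𝓡 (2 * n + s)) M) x = 2 := by exact_mod_cast natCast_apply 2 x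
    rw [hbr, hbr, ← hΨ] at h
    simp only [ContMDiffMap.coe_mul, Pi.mul_apply, ContMDiffMap.coe_add, Pi.add_apply,
      kenmotsuAlgebra_inn_apply, kenmotsuAlgebra_P_apply, kenmotsuAlgebra_β_apply, e2] at h
    exact h
  rw [h2, mvfderiv_mul (φ.mdiffAt x) (Ψ.mdiffAt x), hsol.starRicci_eq hK hN,
    hsol.starRicci_eq hK hN, ← starFactor_apply] at h1
  simp only [add_apply, smul_apply, smul_eq_mul, h3] at h1
  rw [← hφ, hΨx] at h1
  linear_combination h1

theorem mvfderiv_starFactor (x : M) (v : TangentSpace (𝓡 (2 * n + s)) x) :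
    mvfderiv (𝓡 (2 * n + s)) (starFactor β lam δ) x v =
      -β * ∑ j, mvfderiv (𝓡 (2 * n + s)) (δ j) x v := by
  let D : Derivation ℤ (Fn (𝓡 (2 * n + s)) M) (Fn (𝓡 (2 * n + s)) M) := Derivation.mk'
    (AddMonoidHom.mk' (VField.through x v).der (VField.der_add _)).toIntLinearMap
    (VField.der_mul _)
  have h0 (c : ℝ) : D (algebraMap ℝ _ c) = 0 := (VField.through x v).der_algebraMap c
  have h : D (starFactor β lam δ) = algebraMap ℝ _ (-β) * ∑ j, D (δ j) := by
    rw [starFactor, map_add, Derivation.leibniz, h0, h0, smul_zero, zero_add, add_zero, map_sum,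
      smul_eq_mul]
  have h1 := congrArg (fun h : Fn (𝓡 (2 * n + s)) M => h x) h
  have hD (a : Fn (𝓡 (2 * n + s)) M) : D a x = mvfderiv (𝓡 (2 * n + s)) a x v :=
    congrArg (mvfderiv (𝓡 (2 * n + s)) a x) (VField.through_apply x v)
  have h2 : (algebraMap ℝ (Fn (𝓡 (2 * n + s)) M) (-β) * ∑ j, D (δ j)) x =
      -β * (∑ j, D (δ j)) x := rfl
  simp only [h2, Fn.sum_apply, hD] at h1
  exact h1

/-- `φ` is constant along the `ξ_i`. -/
theorem IsStarEtaRicciSoliton.mvfderiv_starFactor_ξ (hn : 0 < n) (hβ : β ≠ 0)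
    (hK : S.IsWeakKenmotsu (fun _ => β)) (hN : S.IsNormal)
    (hsol : S.IsStarEtaRicciSoliton (fun p => ∑ i, δ i p • S.ξ i p) lam mu)
    (i : Fin s) (x : M) :
    mvfderiv (𝓡 (2 * n + s)) (starFactor β lam δ) x (S.ξ i x) = 0 := by
  set φ := starFactor β lam δ with hφ
  have hs : (s : ℝ) ≠ 0 := by
    have := i.pos
    positivity
  -- The left side of `inner_f_f_mul` does not depend on the index, and `g(P·,·)` is nonzero.
  have hij (p : M) (j : Fin s) : mvfderiv (𝓡 (2 * n + s)) φ p (S.ξ j p) =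
      mvfderiv (𝓡 (2 * n + s)) φ p (S.ξ i p) := by
    obtain ⟨u, hu⟩ := S.exists_inner_proj_pos hn p
    have hi := hsol.inner_f_f_mul hK hN i (VField.through p (S.f p u))
      (VField.through p (S.f p u)) p
    rw [hsol.inner_f_f_mul hK hN j] at hi
    simp only [VField.through_apply] at hi
    linarith [mul_right_cancel₀ hu.ne' hi]
  have hc (p : M) : mvfderiv (𝓡 (2 * n + s)) φ p (S.ξ i p) = -β * s * (lam + mu) := by
    have h1 : ∑ j, mvfderiv (𝓡 (2 * n + s)) φ p (S.ξ j p) =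
        s * mvfderiv (𝓡 (2 * n + s)) φ p (S.ξ i p) := by
      simp [hij p]
    -- Only the symmetric part of `ξ_j δ^k` is known, but the double sum sees nothing else.
    have h2 : ∑ j, ∑ k, mvfderiv (𝓡 (2 * n + s)) (δ k) p (S.ξ j p) = s * s * (lam + mu) := by
      have h3 : ∑ j, ∑ k, (mvfderiv (𝓡 (2 * n + s)) (δ k) p (S.ξ j p) +
          mvfderiv (𝓡 (2 * n + s)) (δ j) p (S.ξ k p)) = s * s * (2 * (lam + mu)) := by
        simp [hsol.mvfderiv_ξ hK hN, mul_assoc]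
      simp only [Finset.sum_add_distrib] at h3
      rw [Finset.sum_comm (f := fun j k => mvfderiv (𝓡 (2 * n + s)) (δ j) p (S.ξ k p))] at h3
      linarith
    simp only [hφ, mvfderiv_starFactor, ← Finset.mul_sum, h2] at h1
    rw [mvfderiv_starFactor]
    refine mul_left_cancel₀ hs ?_
    linear_combination -h1
  set K := S.kenmotsuAlgebra hK hN with hKdef
  -- With the constant value of `ξ_i φ` inserted, `e` is the factor in `2sβ³ g(f·,f·) = e g(P·,·)`.
  -- It is therefore constant along `ξ_i`, and so is `φ`.
  set e : Fn (𝓡 (2 * n + s)) M :=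
    algebraMap ℝ _ (β * s * (lam + mu)) + algebraMap ℝ _ (-(2 * β)) * φ with he
  obtain ⟨u, hu⟩ := S.exists_inner_proj_pos hn x
  have h := congrArg (fun h : Fn (𝓡 (2 * n + s)) M => h x)
    (K.der_ξ_mul_inn_P_eq_zero i (c := algebraMap ℝ _ (2 * s * β ^ 3)) (e := e)
      ((S.ξField i).der_algebraMap _) (fun X Y => by
        ext p
        have h1 := hsol.inner_f_f_mul hK hN i X Y p
        rw [← hφ, hc p, ← kenmotsuAlgebra_P_apply hK hN] at h1
        refine Eq.trans h1 ?_
        rw [ContMDiffMap.coe_mul, Pi.mul_apply]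
        congr 1
        have h2 : e p = β * s * (lam + mu) + -(2 * β) * φ p := rfl
        rw [h2]
        ring) (VField.through x (S.f x u)) (VField.through x (S.f x u)))
  have hd : K.der (K.ξ i) e x = -(2 * β) * mvfderiv (𝓡 (2 * n + s)) φ x (S.ξ i x) := by
    rw [he, map_add, Derivation.leibniz]
    have h0 (c : ℝ) : K.der (K.ξ i) (algebraMap ℝ _ c) = 0 := (S.ξField i).der_algebraMap c
    rw [h0, h0, smul_zero, zero_add, add_zero]
    rfl
  simp only [ContMDiffMap.coe_mul, Pi.mul_apply] at h
  rw [hd, kenmotsuAlgebra_inn_apply, kenmotsuAlgebra_P_apply, VField.through_apply] at h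
  have h' := (mul_eq_zero.1 h).resolve_right hu.ne'
  exact (mul_eq_zero.1 h').resolve_left (by simpa using hβ)

theorem IsStarEtaRicciSoliton.inner_f_f (hn : 0 < n) (hs : 0 < s) (hβ : β ≠ 0)
    (hK : S.IsWeakKenmotsu (fun _ => β)) (hN : S.IsNormal)
    (hsol : S.IsStarEtaRicciSoliton (fun p => ∑ i, δ i p • S.ξ i p) lam mu)
    (x : M) (u v : TangentSpace (𝓡 (2 * n + s)) x) :
    s * β ^ 2 * S.g.inner x (S.f x u) (S.f x v) =
      -starFactor β lam δ x * S.g.inner x (S.proj x u) v := by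
  have h := hsol.inner_f_f_mul hK hN ⟨0, hs⟩ (VField.through x u) (VField.through x v) x
  rw [hsol.mvfderiv_starFactor_ξ hn hβ hK hN] at h
  simp only [VField.through_apply] at h
  refine mul_left_cancel₀ (mul_ne_zero two_ne_zero hβ) ?_
  linear_combination h

/-- A `*`-`η`-Ricci soliton whose potential lies in the span of the `ξ_i` is `η`-Einstein. -/
theorem IsStarEtaRicciSoliton.isEtaEinstein (hn : 0 < n) (hs : 0 < s) (hβ : β ≠ 0)
    (hK : S.IsWeakKenmotsu (fun _ => β)) (hN : S.IsNormal)
    (hsol : S.IsStarEtaRicciSoliton (fun p => ∑ i, δ i p • S.ξ i p) lam mu) :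
    S.IsEtaEinstein (fun _ => -2 * s * n * β ^ 2) (fun _ => 2 * ((s : ℝ) - 1) * n * β ^ 2) where
  smooth_a := contMDiff_const
  smooth_b := contMDiff_const
  eq x u v := by
    have hs' : (s : ℝ) * β ^ 2 ≠ 0 := by positivity
    -- `q` is the ratio of `g(f·,f·)` to `g(P·,·)` at the point `x`; it drops out of the Ricci
    -- tensor, so its dependence on `x` plays no role.
    set q := -starFactor β lam δ x / (s * β ^ 2) with hq
    have hq' : starFactor β lam δ x = -(s * β ^ 2 * q) := by
      rw [hq]
      field_simp
    have hfq (u v : TangentSpace (𝓡 (2 * n + s)) x) :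
        S.g.inner x (S.f x u) (S.f x v) = q * S.g.inner x (S.proj x u) v := by
      refine mul_left_cancel₀ hs' ?_
      rw [hsol.inner_f_f hn hs hβ hK hN, hq']
      ring
    -- If `q` were zero, `f` would vanish at `x`, against rank `2n > 0`.
    have hq0 : q ≠ 0 := by
      intro h0
      obtain ⟨u, hu⟩ := S.exists_inner_proj_pos hn x
      rw [proj_f, hfq, h0, zero_mul] at hu
      exact hu.false
    have hff (u : TangentSpace (𝓡 (2 * n + s)) x) : S.f x (S.f x u) = -q • S.proj x u := by
      refine eq_of_inner_eq S.g fun w => ?_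
      rw [S.f_skew, hfq]
      simp
    rw [ricci_eq_of_starRicci hK hN hq0 hff (fun u v => by
      rw [hsol.starRicci_eq hK hN, ← starFactor_apply, hq', hfq]
      ring), inner_proj]
    ring

end Soliton

end WeakMetricFStructure

end WeakMetric

end

/-! ### The main theorem. -/

theorem theorem7 {n s : ℕ} (hn : 0 < n) (hs : 1 < s)
    {M : Type*} [TopologicalSpace M] [T2Space M] [SecondCountableTopology M]
    [ChartedSpace (EuclideanSpace ℝ (Fin (2 * n + s))) M]
    [IsManifold (𝓡 (2 * n + s)) ∞ M]
    (S : WeakMetric.WeakMetricFStructure n s M) (hN : S.IsNormal)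
    (β : ℝ) (hβ : β ≠ 0) (hK : S.IsWeakKenmotsu (fun _ => β))
    (V : Π x : M, TangentSpace (𝓡 (2 * n + s)) x) (lam mu : ℝ)
    (hsol : S.IsStarEtaRicciSoliton V lam mu)
    (δ : Fin s → M → ℝ) (hδ : ∀ i, ContMDiff (𝓡 (2 * n + s)) 𝓘(ℝ) ∞ (δ i))
    (hV : ∀ x, V x = ∑ i, δ i x • S.ξ i x) (hV0 : ∃ x, V x ≠ 0) :
    (∀ i x (u : TangentSpace (𝓡 (2 * n + s)) x), S.InD x u → mvfderiv (𝓡 (2 * n + s)) (δ i) x u = 0) ∧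
      S.IsEtaEinstein (fun _ => -2 * s * n * β ^ 2) (fun _ => 2 * ((s : ℝ) - 1) * n * β ^ 2) ∧
      ∀ x, WeakMetric.scalarCurvature S.g x = -2 * s * n * (2 * n + 1) * β ^ 2 := by
  obtain rfl : V = fun x => ∑ i, δ i x • S.ξ i x := funext hV
  let δ' : Fin s → WeakMetric.Fn (𝓡 (2 * n + s)) M := fun i => ⟨δ i, hδ i⟩
  have hsol' : S.IsStarEtaRicciSoliton (fun p => ∑ i, δ' i p • S.ξ i p) lam mu := hsol
  have hE := hsol'.isEtaEinstein hn (by omega) hβ hK hN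
  refine ⟨fun i x u hu => hsol'.mvfderiv_eq_zero hK hN i hu, hE, fun x => ?_⟩
  -- `r = 2na + s(a + b)` with `a + b = -2nβ²`.
  rw [hE.scalarCurvature_eq]
  ring
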